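/- Let $(A,\mathfrak m)$ be an Artinian local ring with infinite residue field, let $d\ge 1$, let $S=\bigoplus_{\mathbf n\in\mathbb N^d}S_{\mathbf n}$ be a finitely generated standard $\mathbb N^d$-graded $A$-algebra (i.e. $S$ is generated over $A$ by elements of total degree $1$), and let $M=\bigoplus_{\mathbf n\in\mathbb N^d}M_{\mathbf n}$ be a finitely generated $\mathbb N^d$-graded $S$-module. Order $\mathbb N^d$ componentwise; "for all large $\mathbf n$" means for all $\mathbf n\ge\mathbf n_0$, for some $\mathbf n_0\in\mathbb N^d$. Let $\mathbf e_j$ be the $j$-th unit vector, $S_j=S_{\mathbf e_j}$ and $S_{++}=\bigoplus_{\mathbf n\ge(1,\dots,1)}S_{\mathbf n}$. For a finitely generated $\mathbb N^d$-graded $S$-module $N$, let $\operatorname{Supp}_{++}N$ be the set of homogeneous primes $P\not\supseteq S_{++}$ of $S$ with $N_P\ne0$; its dimension is the supremum of the lengths of chains of primes in it, and is $-\infty$ if it is empty. The length $\ell_A(N_{\mathbf n})$ is finite and agrees for all large $\mathbf n$ with a numerical polynomial, written uniquely as $$P_N(\mathbf n)=\sum_{\mathbf k\in\mathbb N^d}e(N;\mathbf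 k)\binom{\mathbf n+\mathbf k}{\mathbf k},\qquad e(N;\mathbf k)\in\mathbb Z,\qquad \binom{\mathbf n+\mathbf k}{\mathbf k}=\prod_{j=1}^d\binom{n_j+k_j}{k_j}.$$ The mixed multiplicity $e(N;\mathbf k)$ of type $\mathbf k$ is said to be defined if $e(N;\mathbf h)=0$ for all $\mathbf h>\mathbf k$ (that is, $\mathbf h\ge\mathbf k$ and $\mathbf h\ne\mathbf k$). A sequence of elements of $\bigcup_j S_j$ consisting of $k_1$ elements of $S_1$, …, $k_d$ elements of $S_d$ is said to be of type $\mathbf k=(k_1,\dots,k_d)$. (Each member is regarded as taken from one specified $S_j$, which matters only for the zero element.) Let $\mathbf x=x_1,\dots,x_s$ be a mixed multiplicity system of $M$ of type $\mathbf k$, i.e. a sequence of type $\mathbf k$ with $\dim\operatorname{Supp}_{++}(M/\mathbf xM)\le0$, and for $1\le i\le s$ let $\mathbf h_i$ be the type of $x_1,\dots,x_i$. Then the mixed multiplicity of $M$ of type $\mathbf k$ is defined, and for each $1\le i\le s$ the mixed multiplicity of $\dfrac{(x_1,\dots,x_{i-1})M:x_i}{(x_1,\dots,x_{i-1})M}$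 of type $\mathbf k-\mathbf h_i$ is defined, where $(x_1,\dots,x_{i-1})M:x_i=\{m\in M: x_im\in(x_1,\dots,x_{i-1})M\}$. Moreover, for all large $\mathbf n$, $$e(M;\mathbf k)=\ell_A\big[(M/\mathbf xM)_{\mathbf n}\big]-\sum_{i=1}^s e\left(\frac{(x_1,\dots,x_{i-1})M:x_i}{(x_1,\dots,x_{i-1})M};\ \mathbf k-\mathbf h_i\right).$$ -/

import Mathlib

open Filter

namespace MixedMult

section Numerical

variable {d : ℕ}

/-- The value at `n` of the polynomial `∑ h, c h * binom (n + h) h`, where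
`binom (n + h) h = ∏ i, binom (n i + h i) (h i)`. -/
noncomputable def binomSum (c : (Fin d → ℕ) →₀ ℤ) (n : Fin d → ℕ) : ℤ :=
  c.sum fun h a => a * ∏ i, ((n i + h i).choose (h i) : ℤ)

/-- `f` is finite and agrees with the polynomial `∑ h, c h * binom (n + h) h` for all large `n`,
that is, for all `n ≥ n₀` (componentwise) for some `n₀`. -/
def IsHilbertExpansion (f : (Fin d → ℕ) → ℕ∞) (c : (Fin d → ℕ) →₀ ℤ) : Prop :=
  ∀ᶠ n in atTop, f n ≠ ⊤ ∧ ((f n).toNat : ℤ) = binomSum c n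

open Classical in
/-- The integer coefficients of the Hilbert polynomial of `f` in the basis `binom (n + h) h`
(with value `0` if `f` has no Hilbert polynomial). They are unique, see
`IsHilbertExpansion.unique`. -/
noncomputable def hilbertCoeff (f : (Fin d → ℕ) → ℕ∞) : (Fin d → ℕ) →₀ ℤ :=
  if hf : ∃ c, IsHilbertExpansion f c then hf.choose else 0

/-- The expansion with the first index lowered by one in direction `j`: backward difference. -/
noncomputable def lower (j : Fin d) (c : (Fin d → ℕ) →₀ ℤ) : (Fin d → ℕ) →₀ ℤ :=
  c.comapDomain (fun h => h + Pi.single j 1) (add_left_injective _).injOn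

theorem binomSum_lower (j : Fin d) (c : (Fin d → ℕ) →₀ ℤ) (n : Fin d → ℕ) :
    binomSum (lower j c) (n + Pi.single j 1)
      = binomSum c (n + Pi.single j 1) - binomSum c n := by
  classical
  have hprod : ∀ (h m : Fin d → ℕ), (∏ i, ((m i + h i).choose (h i) : ℤ))
      = ((m j + h j).choose (h j) : ℤ) *
        ∏ i ∈ Finset.univ.erase j, ((m i + h i).choose (h i) : ℤ) := fun h m =>
    (Finset.mul_prod_erase _ _ (Finset.mem_univ j)).symm
  have herase : ∀ (h m : Fin d → ℕ),
      (∏ i ∈ Finset.univ.erase j, (((m + Pi.single j 1 : Fin d → ℕ) i + h i).choose (h i) : ℤ))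
        = ∏ i ∈ Finset.univ.erase j, ((m i + h i).choose (h i) : ℤ) := fun h m =>
    Finset.prod_congr rfl fun i hi => by simp [Finset.ne_of_mem_erase hi]
  induction c using Finsupp.induction_linear with
  | zero => simp [lower, binomSum]
  | add f g hf hg =>
    have hadd : ∀ (a b : (Fin d → ℕ) →₀ ℤ) (m), binomSum (a + b) m
        = binomSum a m + binomSum b m := fun a b m => by
      unfold binomSum
      exact Finsupp.sum_add_index' (by simp) (by intros; ring)
    have hl : lower j (f + g) = lower j f + lower j g := by ext h; simp [lower]
    rw [hl, hadd, hadd, hadd, hf, hg]; ring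
  | single h a =>
    have hs : ∀ (h : Fin d → ℕ) (a : ℤ) m, binomSum (Finsupp.single h a) m
        = a * ∏ i, ((m i + h i).choose (h i) : ℤ) := fun h a m => by
      unfold binomSum; simp
    rcases Nat.eq_zero_or_pos (h j) with h0 | h0
    · have hz : lower j (Finsupp.single h a) = 0 := by
        ext g
        simp only [lower, Finsupp.comapDomain_apply, Finsupp.coe_zero, Pi.zero_apply]
        rw [Finsupp.single_apply, if_neg]
        rintro rfl
        simp at h0
      rw [hz, hs, hs, hprod h, hprod h n, herase, h0]
      simp [binomSum]
    · obtain ⟨g, rfl⟩ : ∃ g : Fin d → ℕ, h = g + Pi.single j 1 := by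
        refine ⟨h - Pi.single j 1, ?_⟩
        ext i
        by_cases hi : i = j
        · subst hi; simp; omega
        · simp [hi]
      have hz : lower j (Finsupp.single (g + Pi.single j 1) a) = Finsupp.single g a := by
        ext g'
        simp only [lower, Finsupp.comapDomain_apply, Finsupp.single_apply, add_left_inj]
      have he : ∀ m : Fin d → ℕ,
          (∏ i ∈ Finset.univ.erase j, ((m i + (g + Pi.single j 1 : Fin d → ℕ) i).choose
            ((g + Pi.single j 1 : Fin d → ℕ) i) : ℤ))
          = ∏ i ∈ Finset.univ.erase j, ((m i + g i).choose (g i) : ℤ) := fun m =>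
        Finset.prod_congr rfl fun i hi => by simp [Finset.ne_of_mem_erase hi]
      rw [hz, hs, hs, hs, hprod g, hprod _ (n + Pi.single j 1), hprod _ n, he, he, herase]
      have hc : (((n + Pi.single j 1 : Fin d → ℕ) j + (g + Pi.single j 1 : Fin d → ℕ) j).choose
          ((g + Pi.single j 1 : Fin d → ℕ) j) : ℤ)
          = (((n + Pi.single j 1 : Fin d → ℕ) j + g j).choose (g j) : ℤ)
            + ((n j + (g + Pi.single j 1 : Fin d → ℕ) j).choose
              ((g + Pi.single j 1 : Fin d → ℕ) j) : ℤ) := by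
        simp only [Pi.add_apply, Pi.single_eq_same]
        have := Nat.choose_succ_succ (n j + 1 + g j) (g j)
        rw [show n j + 1 + (g j + 1) = (n j + 1 + g j).succ by omega,
          show g j + 1 = (g j).succ by rfl, this,
          show n j + 1 + g j = n j + (g j).succ by omega]
        push_cast; ring
      rw [hc]; ring

theorem eq_zero_of_binomSum (c : (Fin d → ℕ) →₀ ℤ)
    (hc : ∀ᶠ n in atTop, binomSum c n = 0) : c = 0 := by
  classical
  suffices H : ∀ (D : ℕ) (c : (Fin d → ℕ) →₀ ℤ), (∀ h, c h ≠ 0 → ∑ i, h i < D) →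
      (∀ᶠ n in atTop, binomSum c n = 0) → c = 0 from
    H (c.support.sup (fun h => ∑ i, h i) + 1) c (fun h hh => Nat.lt_succ_of_le
      (Finset.le_sup (f := fun h : Fin d → ℕ => ∑ i, h i) (Finsupp.mem_support_iff.2 hh))) hc
  intro D
  induction D with
  | zero =>
    intro c hD _
    ext h
    by_contra hne
    exact absurd (hD h hne) (by omega)
  | succ D ih =>
    intro c hD hc
    have hlow : ∀ j, lower j c = 0 := by
      intro j
      refine ih _ (fun h hh => ?_) ?_
      · have := hD (h + Pi.single j 1) hh
        simp only [Pi.add_apply, Finset.sum_add_distrib, Finset.sum_pi_single',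
          Finset.mem_univ, if_true] at this
        omega
      · obtain ⟨N, hN⟩ := eventually_atTop.1 hc
        refine eventually_atTop.2 ⟨N + Pi.single j 1, fun n hn => ?_⟩
        obtain ⟨m, rfl⟩ := exists_add_of_le hn
        rw [show N + Pi.single j 1 + m = (N + m) + Pi.single j 1 by abel, binomSum_lower,
          hN _ (le_trans le_self_add le_self_add), hN _ le_self_add, sub_zero]
    have hne : ∀ h, h ≠ 0 → c h = 0 := by
      intro h hh
      obtain ⟨j, hj⟩ := Function.ne_iff.1 hh
      have := DFunLike.congr_fun (hlow j) (h - Pi.single j 1)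
      simp only [lower, Finsupp.comapDomain_apply, Finsupp.coe_zero, Pi.zero_apply] at this
      rw [tsub_add_cancel_of_le] at this
      · exact this
      · intro i
        by_cases hi : i = j
        · subst hi
          simp only [Pi.single_eq_same]
          exact Nat.one_le_iff_ne_zero.2 hj
        · simp [hi]
    have hs : c = Finsupp.single 0 (c 0) := by
      ext h
      by_cases hh : h = 0
      · subst hh; simp
      · rw [hne h hh, Finsupp.single_apply, if_neg (Ne.symm hh)]
    obtain ⟨n, hn⟩ := hc.exists
    rw [hs] at hn ⊢
    simp [binomSum] at hn
    simp [hn]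

theorem IsHilbertExpansion.unique {f : (Fin d → ℕ) → ℕ∞} {c c' : (Fin d → ℕ) →₀ ℤ}
    (h : IsHilbertExpansion f c) (h' : IsHilbertExpansion f c') : c = c' := by
  rw [← sub_eq_zero]
  refine eq_zero_of_binomSum _ ?_
  filter_upwards [h, h'] with n hn hn'
  have : binomSum (c - c') n = binomSum c n - binomSum c' n := by
    unfold binomSum
    exact Finsupp.sum_sub_index (by intros; ring)
  rw [this, ← hn.2, ← hn'.2, sub_self]

theorem IsHilbertExpansion.hilbertCoeff_eq {f : (Fin d → ℕ) → ℕ∞} {c : (Fin d → ℕ) →₀ ℤ}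
    (h : IsHilbertExpansion f c) : hilbertCoeff f = c := by
  have hf : ∃ c, IsHilbertExpansion f c := ⟨c, h⟩
  rw [hilbertCoeff, dif_pos hf]
  exact hf.choose_spec.unique h

end Numerical

section Graded

variable {d : ℕ} {A : Type*} [CommRing A]

/-- The Hilbert function `n ↦ ℓ_A (V_n)` of a family of homogeneous components `V_n`. -/
noncomputable def hilbertFunction {V : Type*} [AddCommGroup V] [Module A V]
    (𝒱 : (Fin d → ℕ) → Submodule A V) (n : Fin d → ℕ) : ℕ∞ :=
  Module.length A (𝒱 n)

/-- The integer `e(V; k)`: the coefficient of `binom (n + k) k` in the Hilbert polynomial. -/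
noncomputable def mixedMultiplicity {V : Type*} [AddCommGroup V] [Module A V]
    (𝒱 : (Fin d → ℕ) → Submodule A V) (k : Fin d → ℕ) : ℤ :=
  hilbertCoeff (hilbertFunction 𝒱) k

/-- The mixed multiplicity (of maximal degree) of type `k` is defined: the Hilbert polynomial
exists and `e(V; h) = 0` for all `h > k`, in the componentwise (partial) order. -/
def MixedMultiplicityDefined {V : Type*} [AddCommGroup V] [Module A V]
    (𝒱 : (Fin d → ℕ) → Submodule A V) (k : Fin d → ℕ) : Prop :=
  (∃ c, IsHilbertExpansion (hilbertFunction 𝒱) c) ∧ ∀ h, k < h → mixedMultiplicity 𝒱 h = 0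

variable {S : Type*} [CommRing S] [Algebra A S]

/-- `S` is a finitely generated standard `ℕ^d`-graded `A`-algebra: it is of finite type and
generated over `A` by its elements of total degree one. -/
def IsStandard (𝒜 : (Fin d → ℕ) → Submodule A S) : Prop :=
  Algebra.FiniteType A S ∧
    Algebra.adjoin A (⋃ j : Fin d, (𝒜 (Pi.single j 1) : Set S)) = ⊤

/-- The ideal `S_{++}`, the sum of the components `S_n` with `n ≥ (1, …, 1)`. -/
def irrelevant (𝒜 : (Fin d → ℕ) → Submodule A S) : Ideal S :=
  Ideal.span (⋃ n : {n : Fin d → ℕ // 1 ≤ n}, (𝒜 n : Set S))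

/-- `Supp_{++} M`: the homogeneous primes `P` of `S` not containing `S_{++}` with `M_P ≠ 0`,
ordered by inclusion. -/
def suppPP (𝒜 : (Fin d → ℕ) → Submodule A S) [GradedAlgebra 𝒜]
    (M : Type*) [AddCommGroup M] [Module S M] : Set (PrimeSpectrum S) :=
  {P | P.asIdeal.IsHomogeneous 𝒜 ∧ ¬ irrelevant 𝒜 ≤ P.asIdeal ∧ P ∈ Module.support S M}

variable {M : Type*} [AddCommGroup M] [Module A M] [Module S M] [IsScalarTower A S M]

/-- The induced grading on a quotient `M / N`: degree `n` is the image of `M_n`. -/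
def quotGrading (ℳ : (Fin d → ℕ) → Submodule A M) (N : Submodule S M) (n : Fin d → ℕ) :
    Submodule A (M ⧸ N) :=
  (ℳ n).map (N.mkQ.restrictScalars A)

/-- The induced grading on a submodule `L` of `M`: degree `n` is `L ∩ M_n`. -/
def subGrading (ℳ : (Fin d → ℕ) → Submodule A M) (L : Submodule S M) (n : Fin d → ℕ) :
    Submodule A L :=
  (ℳ n).comap (L.subtype.restrictScalars A)

variable {s : ℕ}

/-- `(x_1, …, x_i) M`, the submodule generated by the first `i` members of the sequence. -/
def initialSubmodule (M : Type*) [AddCommGroup M] [Module S M] (x : Fin s → S) (i : ℕ) :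
    Submodule S M :=
  Ideal.span {a | ∃ l : Fin s, (l : ℕ) < i ∧ x l = a} • (⊤ : Submodule S M)

/-- The module `((x_1, …, x_{i-1}) M : x_i) / (x_1, …, x_{i-1}) M`, as a submodule of
`M / (x_1, …, x_{i-1}) M`. The member `x_i` is `x i` for the zero-based `i : Fin s`. -/
def colonQuotient (M : Type*) [AddCommGroup M] [Module S M] (x : Fin s → S) (i : Fin s) :
    Submodule S (M ⧸ initialSubmodule M x i) :=
  ((initialSubmodule M x i).comap (LinearMap.lsmul S M (x i))).map (initialSubmodule M x i).mkQ

/-- The type of the first `i` members of a sequence whose `l`-th member is taken from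
`S_{t l}`: the `j`-th entry counts the members taken from `S_j`. -/
def initialType (t : Fin s → Fin d) (i : ℕ) : Fin d → ℕ :=
  fun j => (Finset.univ.filter fun l : Fin s => (l : ℕ) < i ∧ t l = j).card

/-- `x` is a mixed multiplicity system of `M` of type `k`, its `l`-th member being taken from
`S_{t l}`. The dimension of the empty set is `⊥`, that is, `-∞`. -/
structure IsMixedMultiplicitySystem (𝒜 : (Fin d → ℕ) → Submodule A S) [GradedAlgebra 𝒜]
    (M : Type*) [AddCommGroup M] [Module S M]
    (x : Fin s → S) (t : Fin s → Fin d) (k : Fin d → ℕ) : Prop where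
  mem : ∀ l, x l ∈ 𝒜 (Pi.single (t l) 1)
  type_eq : initialType t s = k
  dim_le : Order.krullDim (suppPP 𝒜 (M ⧸ initialSubmodule M x s)) ≤ 0

end Graded

end MixedMult

/-! All modules are handled as subquotients `K / L` of `M` by homogeneous submodules, so that by
additivity of length the Hilbert coefficients of `K / L` are `coeff ℳ K - coeff ℳ L`.

Two facts carry the proof. The first (`IsStandard.hasExpansion`) is that the Hilbert function of `K
/ L` is eventually polynomial, that the polynomial is constant when `Supp_{++}` has no proper
inclusions, and that it is zero when `Supp_{++}` is empty. This is a dévissage into cyclic modules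
`S / P` with `P` a homogeneous prime. If `P` does not contain `S_{++}`, each `S_j` contains an
element outside `P`, which acts injectively on `S / P`; the differences of the Hilbert function are
then Hilbert functions of smaller modules, and a function with polynomial differences is polynomial.

The second (`IsStandard.coeff_sup`) comes from multiplication by `x ∈ S_j` on `Q = K / L`: with `c`
the coefficients, `c(Q/xQ)(h) = c(Q)(h + e_j) + c(0 :_Q x)(h) - c(0 :_Q x)(h + e_j)`. Both `Q/xQ`
and `0 :_Q x` are killed by `x`, so descending induction along the sequence shows that the relevant
mixed multiplicities are defined (`IsStandard.coeff_eq_of_tailType_lt`).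

For `Q = M / (x_1, …, x_{i-1})M` and `h = k - h_i` the last term therefore vanishes. With `E_i` the
coefficient of `M / (x_1, …, x_i)M` at `k - h_i`, this says that `E_i - E_{i-1}` is the mixed
multiplicity of the `i`-th colon quotient (`IsMixedMultiplicitySystem.coeff_succ`). The sum
telescopes from `E_0 = e(M; k)` to `E_s`, and `E_s` is the eventual length of `(M / xM)_n` because
that Hilbert polynomial is constant. -/

namespace MixedMult

/-! ### Polynomials in the binomial basis and their differences -/

section Numerical

variable {d : ℕ}

theorem binomSum_add (c c' : (Fin d → ℕ) →₀ ℤ) (n : Fin d → ℕ) :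
    binomSum (c + c') n = binomSum c n + binomSum c' n :=
  Finsupp.sum_add_index' (by simp) (by intros; ring)

theorem binomSum_sub (c c' : (Fin d → ℕ) →₀ ℤ) (n : Fin d → ℕ) :
    binomSum (c - c') n = binomSum c n - binomSum c' n :=
  Finsupp.sum_sub_index (by intros; ring)

@[simp]
theorem binomSum_zero (n : Fin d → ℕ) : binomSum 0 n = 0 := by
  simp [binomSum]

@[simp]
theorem binomSum_single_zero (a : ℤ) (n : Fin d → ℕ) :
    binomSum (Finsupp.single 0 a) n = a := by
  simp [binomSum]

@[simp]
theorem lower_apply (j : Fin d) (c : (Fin d → ℕ) →₀ ℤ) (h : Fin d → ℕ) :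
    lower j c h = c (h + Pi.single j 1) := rfl

theorem eventually_add {p : (Fin d → ℕ) → Prop} (hp : ∀ᶠ n in atTop, p n) (m : Fin d → ℕ) :
    ∀ᶠ n in atTop, p (n + m) := by
  obtain ⟨N, hN⟩ := eventually_atTop.1 hp
  exact eventually_atTop.2 ⟨N, fun n hn => hN _ (hn.trans le_self_add)⟩

theorem eventually_of_eventually_add {p : (Fin d → ℕ) → Prop} (m : Fin d → ℕ)
    (hp : ∀ᶠ n in atTop, p (n + m)) : ∀ᶠ n in atTop, p n := by
  obtain ⟨N, hN⟩ := eventually_atTop.1 hp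
  refine eventually_atTop.2 ⟨N + m, fun n hn => ?_⟩
  obtain ⟨r, rfl⟩ := exists_add_of_le hn
  rw [add_right_comm]
  exact hN _ le_self_add

theorem eq_of_binomSum {c c' : (Fin d → ℕ) →₀ ℤ}
    (h : ∀ᶠ n in atTop, binomSum c n = binomSum c' n) : c = c' := by
  rw [← sub_eq_zero]
  refine eq_zero_of_binomSum _ ?_
  filter_upwards [h] with n hn
  rw [binomSum_sub, hn, sub_self]

theorem sub_single_add_single {h : Fin d → ℕ} {j : Fin d} (hj : h j ≠ 0) :
    h - Pi.single j 1 + Pi.single j 1 = h := by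
  refine tsub_add_cancel_of_le fun i => ?_
  by_cases hi : i = j
  · subst hi
    simpa using Nat.one_le_iff_ne_zero.2 hj
  · simp [hi]

/-- A function whose difference in each direction vanishes for large arguments is eventually
constant. -/
theorem exists_eventually_eq_const {g : (Fin d → ℕ) → ℤ}
    (hg : ∀ j, ∀ᶠ n in atTop, g (n + Pi.single j 1) = g n) :
    ∃ a, ∀ᶠ n in atTop, g n = a := by
  obtain ⟨N, hN⟩ := eventually_atTop.1 (eventually_all.2 hg)
  refine ⟨g N, eventually_atTop.2 ⟨N, fun n hn => ?_⟩⟩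
  obtain ⟨m, rfl⟩ := exists_add_of_le hn
  clear hn
  induction hs : ∑ i, m i generalizing m with
  | zero =>
    have : m = 0 := funext fun i => by simpa using Finset.sum_eq_zero_iff.1 hs i
    simp [this]
  | succ r ih =>
    obtain ⟨j, -, hj⟩ := Finset.exists_ne_zero_of_sum_ne_zero (s := Finset.univ) (f := m)
      (by omega)
    rw [← sub_single_add_single hj] at hs ⊢
    rw [← add_assoc, hN _ le_self_add j]
    refine ih _ ?_
    simp only [Pi.add_apply, Finset.sum_add_distrib, Finset.sum_pi_single',
      Finset.mem_univ, if_true] at hs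
    omega

/-- Compatible families of differences are the differences of an expansion. -/
theorem exists_lower_eq (c : Fin d → (Fin d → ℕ) →₀ ℤ)
    (hc : ∀ i j, lower i (c j) = lower j (c i)) : ∃ b, ∀ j, lower j b = c j := by
  classical
  -- The coefficient at `h ≠ 0` is read off from any direction `j` with `h j ≠ 0`; the compatibility
  -- `hc` makes the choice immaterial. The coefficient at `0` is invisible to every `lower j`.
  let F : (Fin d → ℕ) → ℤ := fun h =>
    if hh : ∃ j, h j ≠ 0 then c hh.choose (h - Pi.single hh.choose 1) else 0
  have hF : ∀ h j, F (h + Pi.single j 1) = c j h := by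
    intro h j
    have hh : ∃ i, (h + Pi.single j 1 : Fin d → ℕ) i ≠ 0 := ⟨j, by simp⟩
    simp only [F, dif_pos hh]
    have hi := hh.choose_spec
    generalize hh.choose = i at hi ⊢
    by_cases hij : i = j
    · subst hij; simp
    · have hi' : h i ≠ 0 := by simpa [hij] using hi
      have h1 := DFunLike.congr_fun (hc i j) (h - Pi.single i 1)
      simp only [lower_apply, sub_single_add_single hi'] at h1
      rw [h1]
      congr 1
      nth_rw 1 [← sub_single_add_single hi']
      rw [add_right_comm, add_tsub_cancel_right]
  have hfin : (Function.support F).Finite := by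
    refine Set.Finite.subset (Set.finite_iUnion fun j =>
      ((c j).support.finite_toSet.image fun h => h + Pi.single j 1)) fun h hh => ?_
    by_cases h0 : ∃ j, h j ≠ 0
    · obtain ⟨j, hj⟩ := h0
      rw [Function.mem_support, ← sub_single_add_single hj, hF] at hh
      exact Set.mem_iUnion.2 ⟨j, _, by simpa using hh, sub_single_add_single hj⟩
    · exact absurd (by simp only [F, dif_neg h0]) hh
  refine ⟨Finsupp.ofSupportFinite F hfin, fun j => ?_⟩
  ext h
  exact hF h j

/-- A function whose differences in all directions agree with polynomials for large arguments
agrees with a polynomial for large arguments. -/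
theorem exists_binomSum_of_differences {g : (Fin d → ℕ) → ℤ} (c : Fin d → (Fin d → ℕ) →₀ ℤ)
    (hg : ∀ j, ∀ᶠ n in atTop,
      g (n + Pi.single j 1) - g n = binomSum (c j) (n + Pi.single j 1)) :
    ∃ b, (∀ᶠ n in atTop, g n = binomSum b n) ∧ ∀ j, lower j b = c j := by
  -- Both sides represent the same mixed second difference of `g`, because differences in two
  -- directions commute.
  have hcomp : ∀ i j, lower i (c j) = lower j (c i) := by
    intro i j
    refine eq_of_binomSum (eventually_of_eventually_add (Pi.single i 1 + Pi.single j 1) ?_)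
    filter_upwards [eventually_add (hg i) (Pi.single j 1), eventually_add (hg j) (Pi.single i 1),
      hg i, hg j] with n h1 h2 h3 h4
    have e1 := binomSum_lower i (c j) (n + Pi.single j 1)
    have e2 := binomSum_lower j (c i) (n + Pi.single i 1)
    rw [add_right_comm n] at e1 h1
    rw [show n + (Pi.single i 1 + Pi.single j 1) = n + Pi.single i 1 + Pi.single j 1 by abel,
      e2, e1, ← h1, ← h2, ← h3, ← h4]
    ring
  obtain ⟨b, hb⟩ := exists_lower_eq c hcomp
  -- The function `g` and the primitive `b` have the same differences, so they differ by an eventual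
  -- constant, which is then added at index `0`.
  obtain ⟨a, ha⟩ := exists_eventually_eq_const (g := fun n => g n - binomSum b n) fun j => by
    filter_upwards [hg j] with n hn
    have := binomSum_lower j b n
    rw [hb, ← hn] at this
    linarith
  refine ⟨b + Finsupp.single 0 a, ?_, fun j => ?_⟩
  · filter_upwards [ha] with n hn
    rw [binomSum_add, binomSum_single_zero, ← hn]
    ring
  · ext h
    rw [← hb, lower_apply, Finsupp.add_apply, Finsupp.single_apply, if_neg, add_zero, lower_apply]
    intro h0
    simpa using congrFun h0.symm j

theorem eq_zero_of_lower_eq_zero {b : (Fin d → ℕ) →₀ ℤ} (hb : ∀ j, lower j b = 0)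
    {h : Fin d → ℕ} (hh : h ≠ 0) : b h = 0 := by
  obtain ⟨j, hj⟩ := Function.ne_iff.1 hh
  have hj' : h j ≠ 0 := by simpa using hj
  have := DFunLike.congr_fun (hb j) (h - Pi.single j 1)
  rwa [lower_apply, sub_single_add_single hj'] at this

end Numerical

/-! ### Homogeneous submodules and homogeneous primes -/

section Homogeneous

variable {d : ℕ} {A : Type*} [CommRing A] {S : Type*} [CommRing S]
  {M : Type*} [AddCommGroup M] [Module A M] [Module S M]
  {ℳ : (Fin d → ℕ) → Submodule A M} [DirectSum.Decomposition ℳ]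

open DirectSum

theorem isHomogeneous_bot : (⊥ : Submodule S M).IsHomogeneous ℳ := by
  rintro n m hm
  rw [show m = 0 from hm]
  simp

theorem isHomogeneous_top : (⊤ : Submodule S M).IsHomogeneous ℳ := fun _ _ _ => trivial

theorem isHomogeneous_inf {K L : Submodule S M} (hK : K.IsHomogeneous ℳ)
    (hL : L.IsHomogeneous ℳ) : (K ⊓ L).IsHomogeneous ℳ :=
  fun n _ hm => ⟨hK n hm.1, hL n hm.2⟩

theorem isHomogeneous_sup {K L : Submodule S M} (hK : K.IsHomogeneous ℳ)
    (hL : L.IsHomogeneous ℳ) : (K ⊔ L).IsHomogeneous ℳ := by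
  intro n m hm
  obtain ⟨k, hk, l, hl, rfl⟩ := Submodule.mem_sup.1 hm
  rw [decompose_add, DirectSum.add_apply, Submodule.coe_add]
  exact Submodule.add_mem_sup (hK n hk) (hL n hl)

theorem mem_of_forall_decompose_mem {L : Submodule S M} {m : M}
    (h : ∀ n, (decompose ℳ m n : M) ∈ L) : m ∈ L := by
  classical
  rw [← sum_support_decompose ℳ m]
  exact Submodule.sum_mem _ fun n _ => h n

end Homogeneous

section Graded

open DirectSum

variable {d : ℕ} {A : Type*} [CommRing A] {S : Type*} [CommRing S] [Algebra A S]
  {𝒜 : (Fin d → ℕ) → Submodule A S} [GradedAlgebra 𝒜]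
  {M : Type*} [AddCommGroup M] [Module A M] [Module S M]
  {ℳ : (Fin d → ℕ) → Submodule A M} [DirectSum.Decomposition ℳ] [SetLike.GradedSMul 𝒜 ℳ]

omit [GradedAlgebra 𝒜] [Decomposition ℳ] in
theorem smul_mem_add {a n : Fin d → ℕ} {x : S} {m : M} (hx : x ∈ 𝒜 a) (hm : m ∈ ℳ n) :
    x • m ∈ ℳ (n + a) := by
  rw [add_comm]
  exact SetLike.GradedSMul.smul_mem hx hm

omit [GradedAlgebra 𝒜] in
theorem decompose_smul_left {a : Fin d → ℕ} {x : S} (hx : x ∈ 𝒜 a) (m : M) (n : Fin d → ℕ) :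
    (decompose ℳ (x • m) (n + a) : M) = x • (decompose ℳ m n : M) := by
  induction m using Decomposition.inductionOn ℳ with
  | zero => simp
  | homogeneous m =>
    rename_i i
    have hxm : x • (m : M) ∈ ℳ (i + a) := smul_mem_add hx m.2
    by_cases hi : i = n
    · subst hi
      rw [decompose_of_mem_same ℳ hxm, decompose_of_mem_same ℳ m.2]
    · rw [decompose_of_mem_ne ℳ hxm (by simpa using hi), decompose_of_mem_ne ℳ m.2 hi, smul_zero]
  | add m m' hm hm' =>
    simp only [smul_add, decompose_add, DirectSum.add_apply, Submodule.coe_add, hm, hm']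

omit [GradedAlgebra 𝒜] in
theorem decompose_smul_left_of_not_le {a n : Fin d → ℕ} {x : S} (hx : x ∈ 𝒜 a) (m : M)
    (hn : ¬ a ≤ n) : (decompose ℳ (x • m) n : M) = 0 := by
  induction m using Decomposition.inductionOn ℳ with
  | zero => simp
  | homogeneous m =>
    refine decompose_of_mem_ne ℳ (smul_mem_add hx m.2) ?_
    rintro rfl
    exact hn le_add_self
  | add m m' hm hm' =>
    simp only [smul_add, decompose_add, DirectSum.add_apply, Submodule.coe_add, hm, hm', add_zero]

theorem decompose_smul_right {a : Fin d → ℕ} {m : M} (hm : m ∈ ℳ a) (x : S) (n : Fin d → ℕ) :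
    (decompose ℳ (x • m) (n + a) : M) = (decompose 𝒜 x n : S) • m := by
  induction x using Decomposition.inductionOn 𝒜 with
  | zero => simp
  | homogeneous x =>
    rename_i i
    have hxm : (x : S) • m ∈ ℳ (a + i) := smul_mem_add x.2 hm
    by_cases hi : i = n
    · subst hi
      rw [add_comm, decompose_of_mem_same ℳ hxm, decompose_of_mem_same 𝒜 x.2]
    · rw [decompose_of_mem_ne ℳ hxm (by rw [add_comm]; simpa using hi),
        decompose_of_mem_ne 𝒜 x.2 hi, zero_smul]
  | add x y hx hy =>
    simp only [add_smul, decompose_add, DirectSum.add_apply, Submodule.coe_add, hx, hy]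

theorem decompose_smul_right_of_not_le (𝒜 : (Fin d → ℕ) → Submodule A S) [GradedAlgebra 𝒜]
    [SetLike.GradedSMul 𝒜 ℳ] {a n : Fin d → ℕ} {m : M} (hm : m ∈ ℳ a) (x : S)
    (hn : ¬ a ≤ n) : (decompose ℳ (x • m) n : M) = 0 := by
  induction x using Decomposition.inductionOn 𝒜 with
  | zero => simp
  | homogeneous x =>
    refine decompose_of_mem_ne ℳ (smul_mem_add x.2 hm) ?_
    rintro rfl
    exact hn le_self_add
  | add x y hx hy =>
    simp only [add_smul, decompose_add, DirectSum.add_apply, Submodule.coe_add, hx, hy, add_zero]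

omit [GradedAlgebra 𝒜] in
theorem isHomogeneous_map_lsmul {K : Submodule S M} (hK : K.IsHomogeneous ℳ) {a : Fin d → ℕ}
    {x : S} (hx : x ∈ 𝒜 a) : (K.map (LinearMap.lsmul S M x)).IsHomogeneous ℳ := by
  rintro n _ ⟨m, hm, rfl⟩
  by_cases hn : a ≤ n
  · obtain ⟨b, rfl⟩ := exists_add_of_le hn
    rw [add_comm a b, LinearMap.lsmul_apply, decompose_smul_left hx]
    exact ⟨_, hK b hm, rfl⟩
  · rw [LinearMap.lsmul_apply, decompose_smul_left_of_not_le hx _ hn]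
    exact zero_mem _

omit [GradedAlgebra 𝒜] in
theorem isHomogeneous_comap_lsmul {L : Submodule S M} (hL : L.IsHomogeneous ℳ) {a : Fin d → ℕ}
    {x : S} (hx : x ∈ 𝒜 a) : (L.comap (LinearMap.lsmul S M x)).IsHomogeneous ℳ := by
  intro n m hm
  have := hL (n + a) (show x • m ∈ L from hm)
  rwa [decompose_smul_left hx] at this

theorem isHomogeneous_span_singleton (𝒜 : (Fin d → ℕ) → Submodule A S) [GradedAlgebra 𝒜]
    [SetLike.GradedSMul 𝒜 ℳ] {a : Fin d → ℕ} {m : M} (hm : m ∈ ℳ a) :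
    (Submodule.span S {m}).IsHomogeneous ℳ := by
  intro n y hy
  obtain ⟨r, rfl⟩ := Submodule.mem_span_singleton.1 hy
  by_cases hn : a ≤ n
  · obtain ⟨b, rfl⟩ := exists_add_of_le hn
    rw [add_comm a b, decompose_smul_right (𝒜 := 𝒜) hm]
    exact Submodule.smul_mem _ _ (Submodule.mem_span_singleton_self m)
  · rw [decompose_smul_right_of_not_le 𝒜 hm _ hn]
    exact zero_mem _

theorem isInternal_lex (_ : DecidableEq (Lex (Fin d → ℕ))) :
    DirectSum.IsInternal (fun n : Lex (Fin d → ℕ) => 𝒜 (ofLex n)) := by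
  have h := Decomposition.isInternal 𝒜
  have hint : ∀ D : DecidableEq (Fin d → ℕ), @DirectSum.IsInternal _ _ _ D _ _ _ 𝒜 := fun D => by
    convert h
  exact hint _

/-- Testing primality on homogeneous elements uses leading components, hence a linear order
compatible with addition. The componentwise order is only partial, so the grading is transported
along `e` to a linearly ordered index monoid; the lexicographic order serves later. -/
theorem isPrime_of_homogeneous_of_addEquiv {ι : Type*} [AddCommMonoid ι] [LinearOrder ι]
    [IsOrderedCancelAddMonoid ι]
    (e : (Fin d → ℕ) ≃+ ι)
    (ℬ : ι → Submodule A S) (hℬ : ∀ n, ℬ n = 𝒜 (e.symm n))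
    (hint : ∀ _ : DecidableEq ι, DirectSum.IsInternal ℬ) {I : Ideal S}
    (hI : I.IsHomogeneous 𝒜) (hne : I ≠ ⊤)
    (h : ∀ a b : Fin d → ℕ, ∀ x ∈ 𝒜 a, ∀ y ∈ 𝒜 b, x * y ∈ I → x ∈ I ∨ y ∈ I) : I.IsPrime := by
  let : GradedRing ℬ :=
    { (hint _).chooseDecomposition with
      one_mem := by
        rw [hℬ, map_zero]
        exact SetLike.GradedOne.one_mem (A := 𝒜)
      mul_mem := fun a b x y hx hy => by
        rw [hℬ] at hx hy ⊢
        rw [map_add]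
        exact SetLike.GradedMul.mul_mem (A := 𝒜) hx hy }
  have hI' : Ideal.IsHomogeneous ℬ I := by
    classical
    intro n r hr
    rw [← sum_support_decompose 𝒜 r, decompose_sum, DFinsupp.finsetSum_apply,
      AddSubmonoidClass.coe_finsetSum]
    refine sum_mem fun i _ => ?_
    have hi : (decompose 𝒜 r i : S) ∈ ℬ (e i) := by
      rw [hℬ, e.symm_apply_apply]
      exact SetLike.coe_mem _
    by_cases hin : e i = n
    · subst hin
      rw [decompose_of_mem_same ℬ hi]
      exact hI i hr
    · rw [decompose_of_mem_ne ℬ hi hin]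
      exact zero_mem _
  refine hI'.isPrime_of_homogeneous_mem_or_mem hne ?_
  rintro x y ⟨a, hx⟩ ⟨b, hy⟩ hxy
  rw [hℬ] at hx hy
  exact h (e.symm a) (e.symm b) x hx y hy hxy

/-- Homogeneous ideals of an `ℕ^d`-graded ring are prime if they satisfy the defining
property for homogeneous elements. -/
theorem isPrime_of_homogeneous {I : Ideal S} (hI : I.IsHomogeneous 𝒜) (hne : I ≠ ⊤)
    (h : ∀ a b : Fin d → ℕ, ∀ x ∈ 𝒜 a, ∀ y ∈ 𝒜 b, x * y ∈ I → x ∈ I ∨ y ∈ I) : I.IsPrime := by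
  exact isPrime_of_homogeneous_of_addEquiv (𝒜 := 𝒜) { toLex with map_add' := fun _ _ => rfl }
    (fun n => 𝒜 (ofLex n)) (fun _ => rfl) isInternal_lex hI hne h

/-- Between two homogeneous submodules there is a homogeneous element with prime colon ideal. -/
theorem exists_isPrime_colon [IsNoetherianRing S] {L K : Submodule S M} (hL : L.IsHomogeneous ℳ)
    (hK : K.IsHomogeneous ℳ) (hLK : ¬ K ≤ L) :
    ∃ a, ∃ m ∈ ℳ a, m ∈ K ∧ m ∉ L ∧ (L.colon {m}).IsPrime ∧ (L.colon {m}).IsHomogeneous 𝒜 := by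
  obtain ⟨y, hyK, hyL⟩ := SetLike.not_le_iff_exists.1 hLK
  obtain ⟨a₀, ha₀⟩ : ∃ a, (decompose ℳ y a : M) ∉ L := by
    by_contra! h
    exact hyL (mem_of_forall_decompose_mem h)
  -- As for associated primes: a maximal member among the annihilators of nonzero homogeneous
  -- classes of `(K + L) / L` is prime.
  let T : Set (Ideal S) := {I | ∃ a, ∃ m ∈ ℳ a, m ∈ K ∧ m ∉ L ∧ I = L.colon {m}}
  obtain ⟨I, ⟨a, m, hma, hmK, hmL, rfl⟩, hmax⟩ := set_has_maximal_iff_noetherian.2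
    (inferInstance : IsNoetherian S S) T ⟨_, a₀, _, SetLike.coe_mem _, hK a₀ hyK, ha₀, rfl⟩
  have hhom : (L.colon {m}).IsHomogeneous 𝒜 := by
    intro n r hr
    rw [Submodule.mem_colon_singleton] at hr ⊢
    rw [← decompose_smul_right hma]
    exact hL _ hr
  refine ⟨a, m, hma, hmK, hmL, isPrime_of_homogeneous hhom ?_ ?_, hhom⟩
  · rw [Ideal.ne_top_iff_one, Submodule.mem_colon_singleton, one_smul]
    exact hmL
  · intro b c r hr r' hr' hrr
    refine or_iff_not_imp_right.2 fun h => ?_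
    rw [Submodule.mem_colon_singleton] at h
    -- If `r' • m` is not in `L`, its annihilator modulo `L` also belongs to `T`, so maximality
    -- forces equality.
    have hle : L.colon {m} ≤ L.colon {r' • m} := fun z hz => by
      rw [Submodule.mem_colon_singleton] at hz ⊢
      rw [smul_comm]
      exact L.smul_mem _ hz
    have heq := eq_of_le_of_not_lt hle
      (hmax _ ⟨_, _, smul_mem_add hr' hma, K.smul_mem _ hmK, h, rfl⟩)
    rw [heq, Submodule.mem_colon_singleton, smul_smul]
    rwa [Submodule.mem_colon_singleton] at hrr

/-! ### Consequences of generation in total degree one -/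

section Standard

theorem IsStandard.decompose_zero_mem (hS : IsStandard 𝒜) (r : S) :
    ∃ a : A, (decompose 𝒜 r 0 : S) = algebraMap A S a := by
  have hr : r ∈ Algebra.adjoin A (⋃ j : Fin d, (𝒜 (Pi.single j 1) : Set S)) := hS.2 ▸ trivial
  induction hr using Algebra.adjoin_induction with
  | mem x hx =>
    obtain ⟨j, hj⟩ := Set.mem_iUnion.1 hx
    refine ⟨0, ?_⟩
    rw [map_zero]
    exact decompose_of_mem_ne 𝒜 hj (by simp)
  | algebraMap a => exact ⟨a, decompose_of_mem_same 𝒜 (SetLike.algebraMap_mem_graded 𝒜 a)⟩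
  | add x y _ _ hx hy =>
    obtain ⟨a, ha⟩ := hx
    obtain ⟨b, hb⟩ := hy
    exact ⟨a + b, by simp [ha, hb]⟩
  | mul x y _ _ hx hy =>
    obtain ⟨a, ha⟩ := hx
    obtain ⟨b, hb⟩ := hy
    refine ⟨a * b, ?_⟩
    have := map_mul (GradedRing.projZeroRingHom 𝒜) x y
    simp only [GradedRing.projZeroRingHom_apply] at this
    rw [this, ha, hb, map_mul]

theorem IsStandard.mem_span_of_pos (hS : IsStandard 𝒜) {j : Fin d} {n : Fin d → ℕ} (hn : n j ≠ 0)
    {r : S} (hr : r ∈ 𝒜 n) : r ∈ Ideal.span (𝒜 (Pi.single j 1) : Set S) := by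
  -- Induction over `Algebra.adjoin` leaves the homogeneous elements, so the claim is made for every
  -- component of an arbitrary element.
  suffices H : ∀ r : S, ∀ n : Fin d → ℕ, n j ≠ 0 →
      (decompose 𝒜 r n : S) ∈ Ideal.span (𝒜 (Pi.single j 1) : Set S) by
    simpa [decompose_of_mem_same 𝒜 hr] using H r n hn
  clear hr hn n r
  intro r
  have hr : r ∈ Algebra.adjoin A (⋃ j : Fin d, (𝒜 (Pi.single j 1) : Set S)) := hS.2 ▸ trivial
  induction hr using Algebra.adjoin_induction with
  | mem x hx =>
    intro n hn
    obtain ⟨i, hi⟩ := Set.mem_iUnion.1 hx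
    by_cases h : Pi.single i 1 = n
    · subst h
      have hij : i = j := by
        by_contra hij
        exact hn (by simp [Ne.symm hij])
      subst hij
      rw [decompose_of_mem_same 𝒜 hi]
      exact Ideal.subset_span hi
    · rw [decompose_of_mem_ne 𝒜 hi h]
      exact zero_mem _
  | algebraMap a =>
    intro n hn
    rw [decompose_of_mem_ne 𝒜 (SetLike.algebraMap_mem_graded 𝒜 a)]
    · exact zero_mem _
    · rintro rfl
      exact hn rfl
  | add x y _ _ hx hy =>
    intro n hn
    rw [decompose_add, DirectSum.add_apply, Submodule.coe_add]
    exact add_mem (hx n hn) (hy n hn)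
  | mul x y _ _ hx hy =>
    classical
    intro n hn
    rw [decompose_mul, DirectSum.coe_mul_apply]
    refine sum_mem fun p hp => ?_
    have hp' : p.1 + p.2 = n := (Finset.mem_filter.1 hp).2
    by_cases h1 : p.1 j = 0
    · refine Ideal.mul_mem_left _ _ (hy _ fun h2 => hn ?_)
      rw [← hp', Pi.add_apply, h1, h2]
    · exact Ideal.mul_mem_right _ _ (hx _ h1)

/-- Every element of degree at least `(1, …, 1)` is a combination of elements of `S_j`, so a prime
containing `S_j` would contain `S_{++}`. -/
theorem IsStandard.exists_notMem (hS : IsStandard 𝒜) {P : Ideal S} (hP : ¬ irrelevant 𝒜 ≤ P)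
    (j : Fin d) :
    ∃ x ∈ 𝒜 (Pi.single j 1), x ∉ P := by
  by_contra! h
  refine hP (Ideal.span_le.2 (Set.iUnion_subset fun n r hr => ?_))
  exact Ideal.span_le.2 h (hS.mem_span_of_pos (Nat.one_le_iff_ne_zero.1 (n.2 j)) hr)

omit [GradedAlgebra 𝒜] in
theorem IsStandard.isNoetherianRing (hS : IsStandard 𝒜) [IsNoetherianRing A] : IsNoetherianRing S :=
  haveI := hS.1
  Algebra.FiniteType.isNoetherianRing A S

theorem IsStandard.component_fg [IsScalarTower A S M] [IsNoetherian S M]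
    (hS : IsStandard 𝒜) (n : Fin d → ℕ) : (ℳ n).FG := by
  classical
  obtain ⟨T, hT, hTs⟩ := (Submodule.fg_span_iff_fg_span_finset_subset (R := S)
    (ℳ n : Set M)).1 (IsNoetherian.noetherian _)
  refine ⟨T, le_antisymm (Submodule.span_le.2 hT) fun m hm => ?_⟩
  -- The generators in `T` all have degree `n`, so taking degree `n` components replaces each
  -- coefficient by its degree `0` part, which comes from `A`.
  have key : ∀ y ∈ Submodule.span S (T : Set M), ∀ r : S,
      (decompose ℳ (r • y) n : M) ∈ Submodule.span A (T : Set M) := by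
    intro y hy
    induction hy using Submodule.span_induction with
    | mem y hy =>
      intro r
      obtain ⟨a, ha⟩ := hS.decompose_zero_mem r
      have := decompose_smul_right (𝒜 := 𝒜) (hT hy) r 0
      rw [zero_add] at this
      rw [this, ha, algebraMap_smul]
      exact Submodule.smul_mem _ _ (Submodule.subset_span hy)
    | zero => simp
    | add y z _ _ hy hz =>
      intro r
      rw [smul_add, decompose_add, DirectSum.add_apply, Submodule.coe_add]
      exact add_mem (hy r) (hz r)
    | smul r y _ hy =>
      intro r'
      rw [smul_smul]
      exact hy _
  have := key m (hTs ▸ Submodule.subset_span hm) 1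
  rwa [one_smul, decompose_of_mem_same ℳ hm] at this

end Standard

end Graded

section Length

variable {A : Type*} [CommRing A] {M : Type*} [AddCommGroup M] [Module A M]
  {N : Type*} [AddCommGroup N] [Module A N]

theorem length_eq_length_inf_ker_add_length_map (U : Submodule A M) (f : M →ₗ[A] N) :
    Module.length A U =
      Module.length A (U ⊓ LinearMap.ker f : Submodule A M) + Module.length A (U.map f) := by
  refine Module.length_eq_add_of_exact (Submodule.inclusion inf_le_left) (f.submoduleMap U)
    (Submodule.inclusion_injective _) (f.submoduleMap_surjective U) ?_
  intro u
  rw [← Submodule.coe_eq_zero, LinearMap.submoduleMap_coe_apply]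
  constructor
  · intro hu
    exact ⟨⟨u, u.2, hu⟩, rfl⟩
  · rintro ⟨v, rfl⟩
    exact v.2.2

end Length

/-! ### Polynomiality of Hilbert functions by dévissage -/

section Graded

open DirectSum

variable {d : ℕ} {A : Type*} [CommRing A] {S : Type*} [CommRing S] [Algebra A S]
  {𝒜 : (Fin d → ℕ) → Submodule A S} [GradedAlgebra 𝒜]
  {M : Type*} [AddCommGroup M] [Module A M] [Module S M] [IsScalarTower A S M]
  {ℳ : (Fin d → ℕ) → Submodule A M} [DirectSum.Decomposition ℳ] [SetLike.GradedSMul 𝒜 ℳ]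

theorem IsStandard.length_ne_top [IsArtinianRing A] [IsNoetherian S M] (hS : IsStandard 𝒜)
    {n : Fin d → ℕ} {U : Submodule A M} (hU : U ≤ ℳ n) : Module.length A U ≠ ⊤ := by
  have : Module.Finite A (ℳ n) := Module.Finite.iff_fg.2 (hS.component_fg n)
  exact ne_top_of_le_ne_top Module.length_ne_top
    (Module.length_le_of_injective (Submodule.inclusion hU) (Submodule.inclusion_injective hU))

variable (ℳ) in
/-- The component of degree `n` of a submodule, as a submodule over the base ring. -/
def component (K : Submodule S M) (n : Fin d → ℕ) : Submodule A M :=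
  K.restrictScalars A ⊓ ℳ n

omit [Decomposition ℳ] in
theorem mem_component {K : Submodule S M} {n : Fin d → ℕ} {m : M} :
    m ∈ component ℳ K n ↔ m ∈ K ∧ m ∈ ℳ n := Iff.rfl

variable (ℳ) in
/-- The Hilbert function of a submodule, as an integer valued function. -/
noncomputable def hilb (K : Submodule S M) (n : Fin d → ℕ) : ℤ :=
  (Module.length A (component ℳ K n)).toNat

/-- Multiplication by `x` on `K / L` has cokernel `K / (L + x K)` and kernel
`(K ∩ (L : x)) / L`. -/
theorem IsStandard.hilb_sup_sub_hilb [IsArtinianRing A] [IsNoetherian S M] (hS : IsStandard 𝒜)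
    {L K : Submodule S M} (hL : L.IsHomogeneous ℳ) (hK : K.IsHomogeneous ℳ)
    {a : Fin d → ℕ} {x : S} (hx : x ∈ 𝒜 a) (n : Fin d → ℕ) :
    hilb ℳ (L ⊔ K.map (LinearMap.lsmul S M x)) (n + a) - hilb ℳ L (n + a) =
      hilb ℳ K n - hilb ℳ (K ⊓ L.comap (LinearMap.lsmul S M x)) n := by
  let f : M →ₗ[A] M ⧸ L := (L.mkQ ∘ₗ LinearMap.lsmul S M x).restrictScalars A
  let g : M →ₗ[A] M ⧸ L := L.mkQ.restrictScalars A
  have hf : ∀ m, f m = 0 ↔ x • m ∈ L := fun m => Submodule.Quotient.mk_eq_zero L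
  have hg : ∀ m, g m = 0 ↔ m ∈ L := fun m => Submodule.Quotient.mk_eq_zero L
  have hker : component ℳ K n ⊓ LinearMap.ker f =
      component ℳ (K ⊓ L.comap (LinearMap.lsmul S M x)) n := by
    ext m
    simp only [Submodule.mem_inf, mem_component, LinearMap.mem_ker, hf, Submodule.mem_comap,
      LinearMap.lsmul_apply]
    tauto
  have hker' : component ℳ (L ⊔ K.map (LinearMap.lsmul S M x)) (n + a) ⊓ LinearMap.ker g =
      component ℳ L (n + a) := by
    ext m
    simp only [Submodule.mem_inf, mem_component, LinearMap.mem_ker, hg]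
    exact ⟨fun h => ⟨h.2, h.1.2⟩, fun h => ⟨⟨Submodule.mem_sup_left h.1, h.2⟩, h.1⟩⟩
  have hmap : (component ℳ K n).map f =
      (component ℳ (L ⊔ K.map (LinearMap.lsmul S M x)) (n + a)).map g := by
    apply le_antisymm
    · rintro _ ⟨m, hm, rfl⟩
      exact ⟨x • m, ⟨Submodule.mem_sup_right ⟨m, hm.1, rfl⟩, smul_mem_add hx hm.2⟩, rfl⟩
    · rintro _ ⟨y, ⟨hy, hyn⟩, rfl⟩
      obtain ⟨l, hl, _, ⟨m, hm, rfl⟩, rfl⟩ := Submodule.mem_sup.1 hy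
      -- The preimage `m` need not be homogeneous; its degree `n` component works, as the degree `n
      -- + a` component of `l` stays in `L`.
      refine ⟨decompose ℳ m n, ⟨hK n hm, SetLike.coe_mem _⟩, ?_⟩
      have hdec := decompose_of_mem_same ℳ hyn
      rw [decompose_add, DirectSum.add_apply, Submodule.coe_add, LinearMap.lsmul_apply,
        decompose_smul_left hx] at hdec
      rw [LinearMap.lsmul_apply, ← hdec, map_add, (hg _).2 (hL _ hl), zero_add]
      rfl
  have h1 := length_eq_length_inf_ker_add_length_map (component ℳ K n) f
  have h2 := length_eq_length_inf_ker_add_length_map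
    (component ℳ (L ⊔ K.map (LinearMap.lsmul S M x)) (n + a)) g
  rw [hker, hmap] at h1
  rw [hker'] at h2
  have hfin : ∀ (U : Submodule S M) (b : Fin d → ℕ), Module.length A (component ℳ U b) ≠ ⊤ :=
    fun U b => hS.length_ne_top (ℳ := ℳ) inf_le_right
  have hmfin := ne_top_of_le_ne_top (hfin _ _) (le_add_self.trans h2.ge)
  unfold hilb
  rw [h1, h2, ENat.toNat_add (hfin _ _) hmfin, ENat.toNat_add (hfin _ _) hmfin]
  push_cast
  ring

variable (𝒜) in
/-- The homogeneous primes containing `I` and not containing `S_{++}`. -/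
def zeroLocusPP (I : Ideal S) : Set (PrimeSpectrum S) :=
  {P | P.asIdeal.IsHomogeneous 𝒜 ∧ ¬ irrelevant 𝒜 ≤ P.asIdeal ∧ I ≤ P.asIdeal}

theorem zeroLocusPP_anti {I J : Ideal S} (h : I ≤ J) : zeroLocusPP 𝒜 J ⊆ zeroLocusPP 𝒜 I :=
  fun _ hP => ⟨hP.1, hP.2.1, h.trans hP.2.2⟩

variable (𝒜 ℳ) in
/-- The Hilbert function of `K / L` agrees with a polynomial for large arguments, which is
constant if `Supp_{++}` has no proper inclusions, and zero if `Supp_{++}` is empty. -/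
def HasExpansion (L K : Submodule S M) : Prop :=
  ∃ c, (∀ᶠ n in atTop, hilb ℳ K n - hilb ℳ L n = binomSum c n) ∧
    (IsAntichain (· ≤ ·) (zeroLocusPP 𝒜 (L.colon (K : Set M))) → ∀ h ≠ 0, c h = 0) ∧
    (zeroLocusPP 𝒜 (L.colon (K : Set M)) = ∅ → c = 0)

omit [Decomposition ℳ] [SetLike.GradedSMul 𝒜 ℳ] in
theorem HasExpansion.refl (L : Submodule S M) : HasExpansion 𝒜 ℳ L L :=
  ⟨0, by simp⟩

theorem colon_anti_right {L K K' : Submodule S M} (h : K ≤ K') :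
    L.colon (K' : Set M) ≤ L.colon (K : Set M) := fun r hr => by
  rw [Submodule.mem_colon] at hr ⊢
  exact fun m hm => hr m (h hm)

theorem colon_mono_left {L L' K : Submodule S M} (h : L ≤ L') :
    L.colon (K : Set M) ≤ L'.colon (K : Set M) := fun r hr => by
  rw [Submodule.mem_colon] at hr ⊢
  exact fun m hm => h (hr m hm)

omit [Decomposition ℳ] [SetLike.GradedSMul 𝒜 ℳ] in
-- Expansions add along `L ≤ K ≤ N`. The `Supp_{++}` of each piece lies in that of `N / L`, and both
-- being an antichain and being empty pass to subsets.
theorem HasExpansion.trans {L K N : Submodule S M} (hLK : L ≤ K) (hKN : K ≤ N)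
    (h : HasExpansion 𝒜 ℳ L K) (h' : HasExpansion 𝒜 ℳ K N) : HasExpansion 𝒜 ℳ L N := by
  obtain ⟨c, hc, hc1, hc2⟩ := h
  obtain ⟨c', hc', hc1', hc2'⟩ := h'
  have hV := zeroLocusPP_anti (𝒜 := 𝒜) (colon_anti_right (L := L) hKN)
  have hV' := zeroLocusPP_anti (𝒜 := 𝒜) (colon_mono_left (K := N) hLK)
  refine ⟨c + c', ?_, fun hA b hb => ?_, fun hE => ?_⟩
  · filter_upwards [hc, hc'] with n hn hn'
    rw [binomSum_add, ← hn, ← hn']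
    ring
  · rw [Finsupp.add_apply, hc1 (hA.subset hV) b hb, hc1' (hA.subset hV') b hb, add_zero]
  · rw [hc2 (Set.subset_eq_empty hV hE), hc2' (Set.subset_eq_empty hV' hE), add_zero]

theorem colon_sup_span_singleton (L : Submodule S M) (m : M) :
    L.colon ((L ⊔ Submodule.span S {m} : Submodule S M) : Set M) = L.colon {m} := by
  ext r
  rw [Submodule.mem_colon, Submodule.mem_colon_singleton]
  refine ⟨fun h => h m (Submodule.mem_sup_right (Submodule.mem_span_singleton_self m)), ?_⟩
  intro h y hy
  obtain ⟨l, hl, _, hz, rfl⟩ := Submodule.mem_sup.1 hy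
  obtain ⟨r', rfl⟩ := Submodule.mem_span_singleton.1 hz
  rw [smul_add, smul_comm]
  exact add_mem (L.smul_mem _ hl) (L.smul_mem _ h)

/-- The step of the dévissage: the cyclic module `(L + S m) / L` whose annihilator is prime. -/
theorem IsStandard.hasExpansion_sup_span_singleton [IsArtinianRing A] [IsNoetherian S M]
    (hS : IsStandard 𝒜) {L : Submodule S M} (hL : L.IsHomogeneous ℳ) {a : Fin d → ℕ} {m : M}
    (hm : m ∈ ℳ a) (hP : (L.colon {m}).IsPrime) (hPh : (L.colon {m}).IsHomogeneous 𝒜)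
    (ih : ∀ K : Submodule S M, K.IsHomogeneous ℳ → K ≤ L ⊔ Submodule.span S {m} →
      L.colon {m} < K.colon ((L ⊔ Submodule.span S {m} : Submodule S M) : Set M) →
      HasExpansion 𝒜 ℳ K (L ⊔ Submodule.span S {m})) :
    HasExpansion 𝒜 ℳ L (L ⊔ Submodule.span S {m}) := by
  have hLm : (L ⊔ Submodule.span S {m}).IsHomogeneous ℳ :=
    isHomogeneous_sup hL (isHomogeneous_span_singleton 𝒜 hm)
  have hcolon := colon_sup_span_singleton L m
  have hmem : m ∈ L ⊔ Submodule.span S {m} :=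
    Submodule.mem_sup_right (Submodule.mem_span_singleton_self m)
  by_cases hirr : irrelevant 𝒜 ≤ L.colon {m}
  -- In degrees `n ≥ 1 + a` the coefficient of `m` has degree `n - a ≥ 1`, so it lies in `S_{++}`
  -- and multiplies `m` into `L`.
  · refine ⟨0, eventually_atTop.2 ⟨1 + a, fun n hn => ?_⟩, by simp, by simp⟩
    obtain ⟨b, rfl⟩ := exists_add_of_le hn
    rw [binomSum_zero, sub_eq_zero]
    suffices H : component ℳ (L ⊔ Submodule.span S {m}) (1 + a + b) = component ℳ L (1 + a + b) by
      rw [hilb, hilb, H]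
    refine le_antisymm (fun y hy => ⟨?_, hy.2⟩) fun y hy => ⟨Submodule.mem_sup_left hy.1, hy.2⟩
    obtain ⟨l, hl, _, hz, rfl⟩ := Submodule.mem_sup.1 hy.1
    obtain ⟨r, rfl⟩ := Submodule.mem_span_singleton.1 hz
    have hdec := decompose_of_mem_same ℳ hy.2
    rw [add_right_comm 1 a b, decompose_add, DirectSum.add_apply, Submodule.coe_add,
      decompose_smul_right (𝒜 := 𝒜) hm] at hdec
    rw [← hdec]
    refine add_mem (hL _ hl) (Submodule.mem_colon_singleton.1 (hirr ?_))
    exact Ideal.subset_span (Set.mem_iUnion.2 ⟨⟨1 + b, le_self_add⟩, SetLike.coe_mem _⟩)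
  · choose x hx hxP using fun j => hS.exists_notMem hirr j
    let L' : Fin d → Submodule S M := fun j =>
      L ⊔ (L ⊔ Submodule.span S {m}).map (LinearMap.lsmul S M (x j))
    have hL'h : ∀ j, (L' j).IsHomogeneous ℳ := fun j =>
      isHomogeneous_sup hL (isHomogeneous_map_lsmul hLm (hx j))
    have hL'le : ∀ j, L' j ≤ L ⊔ Submodule.span S {m} := fun j =>
      sup_le le_sup_left (Submodule.map_le_iff_le_comap.2 fun y hy => Submodule.smul_mem _ _ hy)
    have hlt : ∀ j, L.colon {m} <
        (L' j).colon ((L ⊔ Submodule.span S {m} : Submodule S M) : Set M) := fun j => by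
      refine lt_of_le_of_ne (hcolon ▸ colon_mono_left le_sup_left) fun h => hxP j ?_
      rw [h, Submodule.mem_colon]
      exact fun y hy => Submodule.mem_sup_right ⟨y, hy, rfl⟩
    -- Since `x j` is not in the prime `P = L.colon {m}`, it acts injectively on `(L + S m) / L ≅ S
    -- / P`.
    have hinj : ∀ j, (L ⊔ Submodule.span S {m}) ⊓ L.comap (LinearMap.lsmul S M (x j)) = L := by
      intro j
      refine le_antisymm ?_ (le_inf le_sup_left fun y hy => L.smul_mem _ hy)
      rintro y ⟨hy, hxy⟩
      obtain ⟨l, hl, _, hz, rfl⟩ := Submodule.mem_sup.1 hy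
      obtain ⟨r, rfl⟩ := Submodule.mem_span_singleton.1 hz
      refine add_mem hl ?_
      have h1 : x j • (l + r • m) ∈ L := hxy
      rw [smul_add, smul_smul] at h1
      have h2 := (L.add_mem_iff_right (L.smul_mem (x j) hl)).1 h1
      exact Submodule.mem_colon_singleton.1
        ((hP.mem_or_mem (Submodule.mem_colon_singleton.2 h2)).resolve_left (hxP j))
    choose c hc _ hc2 using fun j => ih (L' j) (hL'h j) (hL'le j) (hlt j)
    obtain ⟨b, hb, hbc⟩ := exists_binomSum_of_differences
      (g := fun n => hilb ℳ (L ⊔ Submodule.span S {m}) n - hilb ℳ L n) c fun j => by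
        filter_upwards [eventually_add (hc j) (Pi.single j 1)] with n hn
        have := hS.hilb_sup_sub_hilb hL hLm (hx j) n
        rw [hinj] at this
        rw [← hn]
        linarith
    have hPV : (⟨L.colon {m}, hP⟩ : PrimeSpectrum S) ∈ zeroLocusPP 𝒜 (L.colon {m}) :=
      ⟨hPh, hirr, le_rfl⟩
    refine ⟨b, hb, fun hA h hh => ?_, fun hE => ?_⟩
    -- A prime `Q` in the `Supp_{++}` of the `j`-th cokernel would properly contain `P`, against the
    -- antichain hypothesis. So all cokernels have zero expansion and `b` is constant.
    · refine eq_zero_of_lower_eq_zero (fun j => ?_) hh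
      rw [hbc j]
      refine hc2 j (Set.eq_empty_of_forall_notMem fun Q hQ => ?_)
      rw [hcolon] at hA
      have hQV := zeroLocusPP_anti (𝒜 := 𝒜) (hlt j).le hQ
      have := hA.eq hPV hQV hQV.2.2
      subst this
      exact (hlt j).not_ge hQ.2.2
    · rw [hcolon] at hE
      exact absurd hPV (hE ▸ Set.notMem_empty _)

/-- A double Noetherian induction, on the annihilator of `K / L` and, for fixed annihilator, on `L`.
Splitting off the cyclic piece `(L + S m) / L` leaves `K / (L + S m)`, whose annihilator is larger
or unchanged with a larger `L`. -/
theorem IsStandard.hasExpansion [IsArtinianRing A] [IsNoetherian S M]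
    (hS : IsStandard 𝒜) {L K : Submodule S M} (hL : L.IsHomogeneous ℳ) (hK : K.IsHomogeneous ℳ)
    (hLK : L ≤ K) : HasExpansion 𝒜 ℳ L K := by
  have := hS.isNoetherianRing
  obtain ⟨I, hI⟩ : ∃ I, L.colon (K : Set M) = I := ⟨_, rfl⟩
  induction I using WellFoundedGT.induction generalizing L K with
  | _ I ihI =>
  induction L using WellFoundedGT.induction with
  | _ L ihL =>
  by_cases hKL : K ≤ L
  · obtain rfl := le_antisymm hLK hKL
    exact HasExpansion.refl L
  obtain ⟨a, m, hma, hmK, hmL, hP, hPh⟩ := exists_isPrime_colon (𝒜 := 𝒜) hL hK hKL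
  have hle : L ⊔ Submodule.span S {m} ≤ K :=
    sup_le hLK ((Submodule.span_singleton_le_iff_mem _ _).2 hmK)
  have hlt : L < L ⊔ Submodule.span S {m} := lt_of_le_of_ne le_sup_left fun h =>
    hmL (h ▸ Submodule.mem_sup_right (Submodule.mem_span_singleton_self m))
  have hhom : (L ⊔ Submodule.span S {m}).IsHomogeneous ℳ :=
    isHomogeneous_sup hL (isHomogeneous_span_singleton 𝒜 hma)
  have hIP : I ≤ L.colon {m} := by
    rw [← hI, ← colon_sup_span_singleton]
    exact colon_anti_right hle
  refine HasExpansion.trans le_sup_left hle ?_ ?_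
  · refine hS.hasExpansion_sup_span_singleton hL hma hP hPh fun K' hK' hK'le hK'lt => ?_
    exact ihI _ (hIP.trans_lt hK'lt) hK' hhom hK'le rfl
  · have hIle : I ≤ (L ⊔ Submodule.span S {m}).colon (K : Set M) :=
      hI ▸ colon_mono_left le_sup_left
    rcases hIle.lt_or_eq with h | h
    · exact ihI _ h hhom hK hle rfl
    · exact ihL _ hlt hhom hle h.symm

end Graded

/-! ### Types of initial and final segments of the sequence -/

section Types

variable {d s : ℕ} (t : Fin s → Fin d)

/-- The type of the members of a sequence from the `i`-th on, in zero-based counting. -/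
def tailType (i : ℕ) : Fin d → ℕ :=
  fun j => (Finset.univ.filter fun l : Fin s => i ≤ (l : ℕ) ∧ t l = j).card

theorem tailType_of_le {i : ℕ} (hi : s ≤ i) : tailType t i = 0 := by
  ext j
  simp only [tailType, Pi.zero_apply, Finset.card_eq_zero, Finset.filter_eq_empty_iff]
  intro l _ h
  have := l.2
  omega

theorem initialType_add_tailType (i : ℕ) :
    initialType t i + tailType t i = initialType t s := by
  ext j
  simp only [initialType, tailType, Pi.add_apply]
  rw [← Finset.card_union_of_disjoint]
  · congr 1
    ext l
    have := l.2
    simp only [Finset.mem_union, Finset.mem_filter, Finset.mem_univ, true_and]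
    constructor
    · rintro (h | h)
      exacts [⟨this, h.2⟩, ⟨this, h.2⟩]
    · intro h
      rcases lt_or_ge (l : ℕ) i with h' | h'
      exacts [Or.inl ⟨h', h.2⟩, Or.inr ⟨h', h.2⟩]
  · refine Finset.disjoint_filter.2 fun l _ h h' => ?_
    omega

theorem initialType_sub (i : ℕ) : initialType t s - initialType t i = tailType t i := by
  rw [← initialType_add_tailType t i, add_tsub_cancel_left]

theorem initialType_self : initialType t s = tailType t 0 := by
  rw [← initialType_sub]
  ext j
  simp [initialType]

theorem tailType_eq_succ_add (i : Fin s) :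
    tailType t i = tailType t (i + 1) + Pi.single (t i) 1 := by
  ext j
  have h : (Finset.univ.filter fun l : Fin s => (i : ℕ) ≤ (l : ℕ) ∧ t l = j) =
      (Finset.univ.filter fun l : Fin s => (i : ℕ) + 1 ≤ (l : ℕ) ∧ t l = j) ∪
        (Finset.univ.filter fun l : Fin s => l = i ∧ t i = j) := by
    ext l
    simp only [Finset.mem_union, Finset.mem_filter, Finset.mem_univ, true_and]
    constructor
    · rintro ⟨h1, h2⟩
      rcases h1.eq_or_lt with h | h
      · have : l = i := Fin.ext h.symm
        subst this
        exact Or.inr ⟨rfl, h2⟩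
      · exact Or.inl ⟨h, h2⟩
    · rintro (h | ⟨rfl, h⟩)
      · exact ⟨by omega, h.2⟩
      · exact ⟨le_rfl, h⟩
  simp only [tailType, Pi.add_apply]
  rw [h, Finset.card_union_of_disjoint]
  · congr 1
    by_cases hj : t i = j
    · subst hj
      simp [Finset.filter_eq']
    · simp [hj, Ne.symm hj]
  · refine Finset.disjoint_filter.2 fun l _ h h' => ?_
    rw [h'.1] at h
    omega

end Types

/-! ### Hilbert coefficients and their behaviour under multiplication -/

section Graded

variable {d : ℕ} {A : Type*} [CommRing A] {S : Type*} [CommRing S] [Algebra A S]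
  {𝒜 : (Fin d → ℕ) → Submodule A S} [GradedAlgebra 𝒜]
  {M : Type*} [AddCommGroup M] [Module A M] [Module S M] [IsScalarTower A S M]
  {ℳ : (Fin d → ℕ) → Submodule A M} [DirectSum.Decomposition ℳ] [SetLike.GradedSMul 𝒜 ℳ]

variable (ℳ) in
/-- The coefficients of the Hilbert polynomial of a submodule. -/
noncomputable def coeff (K : Submodule S M) : (Fin d → ℕ) →₀ ℤ :=
  hilbertCoeff fun n => Module.length A (component ℳ K n)

omit [DirectSum.Decomposition ℳ] in
theorem component_bot (n : Fin d → ℕ) : component ℳ (⊥ : Submodule S M) n = ⊥ := by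
  rw [component, Submodule.restrictScalars_bot, bot_inf_eq]

omit [DirectSum.Decomposition ℳ] in
theorem component_top (n : Fin d → ℕ) : component ℳ (⊤ : Submodule S M) n = ℳ n := by
  rw [component, Submodule.restrictScalars_top, top_inf_eq]

omit [DirectSum.Decomposition ℳ] in
theorem hilb_bot (n : Fin d → ℕ) : hilb ℳ (⊥ : Submodule S M) n = 0 := by
  rw [hilb, component_bot, Module.length_bot]
  rfl

section Expansions

variable [IsArtinianRing A] [IsNoetherian S M]

theorem IsStandard.hilb_eq_binomSum_coeff (hS : IsStandard 𝒜) {K : Submodule S M}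
    (hK : K.IsHomogeneous ℳ) : ∀ᶠ n in atTop, hilb ℳ K n = binomSum (coeff ℳ K) n := by
  obtain ⟨c, hc, -⟩ := hS.hasExpansion (𝒜 := 𝒜) isHomogeneous_bot hK bot_le
  have h : IsHilbertExpansion (fun n => Module.length A (component ℳ K n)) c := by
    filter_upwards [hc] with n hn
    rw [hilb_bot, sub_zero] at hn
    exact ⟨hS.length_ne_top (ℳ := ℳ) inf_le_right, hn⟩
  filter_upwards [hc] with n hn
  rw [coeff, h.hilbertCoeff_eq, ← hn, hilb_bot, sub_zero]

theorem IsStandard.coeff_bot (hS : IsStandard 𝒜) : coeff ℳ (⊥ : Submodule S M) = 0 := by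
  refine eq_zero_of_binomSum _ ?_
  filter_upwards [hS.hilb_eq_binomSum_coeff (𝒜 := 𝒜) (ℳ := ℳ) isHomogeneous_bot] with n hn
  rw [← hn, hilb_bot]

theorem IsStandard.coeff_eq_of_isAntichain (hS : IsStandard 𝒜) {L K : Submodule S M}
    (hL : L.IsHomogeneous ℳ) (hK : K.IsHomogeneous ℳ) (hLK : L ≤ K)
    (hA : IsAntichain (· ≤ ·) (zeroLocusPP 𝒜 (L.colon (K : Set M)))) {h : Fin d → ℕ}
    (hh : h ≠ 0) : coeff ℳ K h = coeff ℳ L h := by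
  obtain ⟨c, hc, hc1, -⟩ := hS.hasExpansion (𝒜 := 𝒜) hL hK hLK
  have : coeff ℳ K - coeff ℳ L = c := by
    refine eq_of_binomSum ?_
    filter_upwards [hc, hS.hilb_eq_binomSum_coeff hL, hS.hilb_eq_binomSum_coeff hK] with n h1 h2 h3
    rw [binomSum_sub, ← h1, h2, h3]
  have h0 := hc1 hA h hh
  rw [← this, Finsupp.sub_apply] at h0
  linarith

theorem IsStandard.coeff_sup (hS : IsStandard 𝒜) {L K : Submodule S M}
    (hL : L.IsHomogeneous ℳ) (hK : K.IsHomogeneous ℳ) {j : Fin d} {x : S}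
    (hx : x ∈ 𝒜 (Pi.single j 1)) (h : Fin d → ℕ) :
    coeff ℳ (L ⊔ K.map (LinearMap.lsmul S M x)) h - coeff ℳ L h =
      (coeff ℳ K h - coeff ℳ (K ⊓ L.comap (LinearMap.lsmul S M x)) h) -
        (coeff ℳ K (h + Pi.single j 1) -
          coeff ℳ (K ⊓ L.comap (LinearMap.lsmul S M x)) (h + Pi.single j 1)) := by
  set N := L ⊔ K.map (LinearMap.lsmul S M x)
  set K' := K ⊓ L.comap (LinearMap.lsmul S M x)
  have hN : N.IsHomogeneous ℳ := isHomogeneous_sup hL (isHomogeneous_map_lsmul hK hx)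
  have hK' : K'.IsHomogeneous ℳ := isHomogeneous_inf hK (isHomogeneous_comap_lsmul hL hx)
  have key : coeff ℳ N - coeff ℳ L =
      (coeff ℳ K - coeff ℳ K') - lower j (coeff ℳ K - coeff ℳ K') := by
    refine eq_of_binomSum (eventually_of_eventually_add (Pi.single j 1) ?_)
    filter_upwards [eventually_add (hS.hilb_eq_binomSum_coeff hN) (Pi.single j 1),
      eventually_add (hS.hilb_eq_binomSum_coeff hL) (Pi.single j 1),
      hS.hilb_eq_binomSum_coeff hK, hS.hilb_eq_binomSum_coeff hK'] with n h1 h2 h3 h4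
    rw [binomSum_sub (coeff ℳ K - coeff ℳ K'), binomSum_lower, binomSum_sub, ← h1, ← h2,
      hS.hilb_sup_sub_hilb hL hK hx, sub_sub_cancel, binomSum_sub, ← h3, ← h4]
  simpa using DFunLike.congr_fun key h

/-- If `Supp_{++}` of `K / L` modulo the tail of the sequence has no proper inclusions, then the
mixed multiplicity of `K / L` of the type of the tail is defined. -/
theorem IsStandard.coeff_eq_of_tailType_lt (hS : IsStandard 𝒜) {s : ℕ} {x : Fin s → S}
    {t : Fin s → Fin d} (hx : ∀ l, x l ∈ 𝒜 (Pi.single (t l) 1)) {i : ℕ} (hi : i ≤ s)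
    {L K : Submodule S M} (hL : L.IsHomogeneous ℳ) (hK : K.IsHomogeneous ℳ) (hLK : L ≤ K)
    (hA : IsAntichain (· ≤ ·)
      (zeroLocusPP 𝒜 (L.colon (K : Set M) ⊔ Ideal.span (x '' {l | i ≤ (l : ℕ)}))))
    {h : Fin d → ℕ} (hh : tailType t i < h) : coeff ℳ K h = coeff ℳ L h := by
  induction hi using Nat.decreasingInduction generalizing L K h with
  | self =>
    have hempty : {l : Fin s | s ≤ (l : ℕ)} = ∅ := by
      ext l
      simp
    rw [hempty, Set.image_empty, Ideal.span_empty, sup_bot_eq] at hA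
    rw [tailType_of_le t le_rfl] at hh
    exact hS.coeff_eq_of_isAntichain hL hK hLK hA hh.ne'
  | of_succ i hi ih =>
    have hsucc := tailType_eq_succ_add t ⟨i, hi⟩
    simp only at hsucc
    rw [hsucc] at hh
    -- The index `h` exceeds the tail type, which counts the member `x i`, so one unit in its
    -- direction can be removed. Then `coeff_sup` expresses the coefficient at `h` through the
    -- cokernel at `g` and the kernel at `g` and `h`.
    obtain ⟨g, rfl⟩ : ∃ g : Fin d → ℕ, h = g + Pi.single (t ⟨i, hi⟩) 1 :=
      ⟨h - Pi.single (t ⟨i, hi⟩) 1, (tsub_add_cancel_of_le (le_add_self.trans hh.le)).symm⟩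
    have hg : tailType t (i + 1) < g := lt_of_add_lt_add_right hh
    have hg' : tailType t (i + 1) < g + Pi.single (t ⟨i, hi⟩) 1 := hg.trans_le le_self_add
    have hmem := hx ⟨i, hi⟩
    have hspan : x '' {l : Fin s | i ≤ (l : ℕ)} ⊆
        {x ⟨i, hi⟩} ∪ x '' {l : Fin s | i + 1 ≤ (l : ℕ)} := by
      rintro _ ⟨l, hl, rfl⟩
      rcases (show i ≤ (l : ℕ) from hl).eq_or_lt with h | h
      · exact Or.inl (congrArg x (Fin.ext h.symm))
      · exact Or.inr ⟨l, h, rfl⟩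
    -- The kernel and the cokernel of `x i` on `K / L` are annihilated by `x i`, so the shorter tail
    -- already cuts their `Supp_{++}` down to an antichain.
    have hanti : ∀ J : Ideal S, L.colon (K : Set M) ≤ J → x ⟨i, hi⟩ ∈ J → IsAntichain (· ≤ ·)
        (zeroLocusPP 𝒜 (J ⊔ Ideal.span (x '' {l | i + 1 ≤ (l : ℕ)}))) := by
      intro J h1 h2
      refine hA.subset (zeroLocusPP_anti (sup_le (h1.trans le_sup_left) ?_))
      refine Ideal.span_le.2 (hspan.trans (Set.union_subset ?_ ?_))
      · exact Set.singleton_subset_iff.2 (Ideal.mem_sup_left h2)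
      · exact fun y hy => Ideal.mem_sup_right (Ideal.subset_span hy)
    have hN := ih (isHomogeneous_sup hL (isHomogeneous_map_lsmul hK hmem)) hK
      (sup_le hLK (Submodule.map_le_iff_le_comap.2 fun y hy => Submodule.smul_mem _ _ hy))
      (hanti _ (colon_mono_left le_sup_left)
        (Submodule.mem_colon.2 fun y hy => Submodule.mem_sup_right ⟨y, hy, rfl⟩)) hg
    have hK' := fun {h} => ih (h := h) hL
      (isHomogeneous_inf hK (isHomogeneous_comap_lsmul hL hmem))
      (le_inf hLK fun y hy => L.smul_mem _ hy)
      (hanti _ (colon_anti_right inf_le_left) (Submodule.mem_colon.2 fun y hy => hy.2))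
    have hrel := hS.coeff_sup hL hK hmem g
    rw [hK' hg, hK' hg'] at hrel
    linarith

end Expansions

/-! ### Passage from subquotients to the gradings of the statement -/

section Quotients

omit [DirectSum.Decomposition ℳ] [SetLike.GradedSMul 𝒜 ℳ] in
theorem length_quotGrading (N : Submodule S M) (n : Fin d → ℕ) :
    Module.length A (ℳ n) =
      Module.length A (component ℳ N n) + Module.length A (quotGrading ℳ N n) := by
  have hker : ℳ n ⊓ LinearMap.ker (N.mkQ.restrictScalars A) = component ℳ N n := by
    ext m
    simp [mem_component, and_comm]
  rw [length_eq_length_inf_ker_add_length_map (ℳ n) (N.mkQ.restrictScalars A), hker]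
  rfl

omit [DirectSum.Decomposition ℳ] [SetLike.GradedSMul 𝒜 ℳ] in
theorem length_subGrading_quotGrading {N C : Submodule S M} (hNC : N ≤ C) (n : Fin d → ℕ) :
    Module.length A (component ℳ C n) =
      Module.length A (component ℳ N n) +
        Module.length A (subGrading (quotGrading ℳ N) (C.map N.mkQ) n) := by
  rw [length_eq_length_inf_ker_add_length_map (component ℳ C n) (N.mkQ.restrictScalars A)]
  have hker : component ℳ C n ⊓ LinearMap.ker (N.mkQ.restrictScalars A) = component ℳ N n := by
    ext m
    simp only [Submodule.mem_inf, mem_component, LinearMap.mem_ker, LinearMap.coe_restrictScalars,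
      Submodule.mkQ_apply, Submodule.Quotient.mk_eq_zero]
    exact ⟨fun h => ⟨h.2, h.1.2⟩, fun h => ⟨⟨hNC h.1, h.2⟩, h.1⟩⟩
  have hmap : (subGrading (quotGrading ℳ N) (C.map N.mkQ) n).map
      ((C.map N.mkQ).subtype.restrictScalars A) =
        (component ℳ C n).map (N.mkQ.restrictScalars A) := by
    apply le_antisymm
    · rintro _ ⟨⟨_, c, hc, rfl⟩, ⟨m, hm, hmc⟩, rfl⟩
      refine ⟨m, ⟨?_, hm⟩, hmc⟩
      have : m - c ∈ N := (Submodule.Quotient.eq N).1 hmc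
      simpa using C.add_mem (hNC this) hc
    · rintro _ ⟨m, hm, rfl⟩
      exact ⟨⟨N.mkQ m, m, hm.1, rfl⟩, ⟨m, hm.2, rfl⟩, rfl⟩
  have hbot : LinearMap.ker ((C.map N.mkQ).subtype.restrictScalars A) = ⊥ :=
    LinearMap.ker_eq_bot.2 (Submodule.subtype_injective _)
  rw [hker, ← hmap, length_eq_length_inf_ker_add_length_map
    (subGrading (quotGrading ℳ N) (C.map N.mkQ) n)
    ((C.map N.mkQ).subtype.restrictScalars A), hbot, inf_bot_eq, Module.length_bot, zero_add]

theorem IsHilbertExpansion.mixedMultiplicityDefined {V : Type*} [AddCommGroup V] [Module A V]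
    {𝒱 : (Fin d → ℕ) → Submodule A V} {c : (Fin d → ℕ) →₀ ℤ}
    (hc : IsHilbertExpansion (hilbertFunction 𝒱) c) {k : Fin d → ℕ} (hk : ∀ h, k < h → c h = 0) :
    MixedMultiplicityDefined 𝒱 k := by
  refine ⟨⟨c, hc⟩, fun h hh => ?_⟩
  rw [mixedMultiplicity, hc.hilbertCoeff_eq, hk h hh]

variable [IsArtinianRing A] [IsNoetherian S M]

theorem IsStandard.isHilbertExpansion_of_length_eq (hS : IsStandard 𝒜) {N C : Submodule S M}
    (hN : N.IsHomogeneous ℳ) (hC : C.IsHomogeneous ℳ) {f : (Fin d → ℕ) → ℕ∞}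
    (hf : ∀ n, Module.length A (component ℳ C n) = Module.length A (component ℳ N n) + f n) :
    IsHilbertExpansion f (coeff ℳ C - coeff ℳ N) := by
  filter_upwards [hS.hilb_eq_binomSum_coeff hN, hS.hilb_eq_binomSum_coeff hC] with n h1 h2
  have hfin : ∀ U : Submodule S M, Module.length A (component ℳ U n) ≠ ⊤ := fun U =>
    hS.length_ne_top (ℳ := ℳ) inf_le_right
  have hfn : f n ≠ ⊤ := ne_top_of_le_ne_top (hfin C) (le_add_self.trans (hf n).ge)
  refine ⟨hfn, ?_⟩
  rw [binomSum_sub, ← h1, ← h2, hilb, hilb, hf, ENat.toNat_add (hfin N) hfn]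
  push_cast
  ring

end Quotients

/-! ### Mixed multiplicity systems -/

section Sequences

variable {s : ℕ} (x : Fin s → S)

theorem initialSubmodule_zero : initialSubmodule M x 0 = ⊥ := by
  simp [initialSubmodule]

theorem initialSubmodule_succ (i : Fin s) : initialSubmodule M x (i + 1) =
    initialSubmodule M x i ⊔ (⊤ : Submodule S M).map (LinearMap.lsmul S M (x i)) := by
  have h : {a | ∃ l : Fin s, (l : ℕ) < i + 1 ∧ x l = a} =
      {a | ∃ l : Fin s, (l : ℕ) < i ∧ x l = a} ∪ {x i} := by
    ext a
    constructor
    · rintro ⟨l, hl, rfl⟩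
      rcases (Nat.lt_succ_iff.1 hl).lt_or_eq with h | h
      · exact Or.inl ⟨l, h, rfl⟩
      · exact Or.inr (congrArg x (Fin.ext h))
    · rintro (⟨l, hl, rfl⟩ | rfl)
      · exact ⟨l, by omega, rfl⟩
      · exact ⟨i, by omega, rfl⟩
  rw [initialSubmodule, h, Ideal.span_union, Submodule.sup_smul,
    Submodule.ideal_span_singleton_smul]
  rfl

omit [GradedAlgebra 𝒜] [IsScalarTower A S M] in
theorem isHomogeneous_initialSubmodule {x} {t : Fin s → Fin d}
    (hx : ∀ l, x l ∈ 𝒜 (Pi.single (t l) 1)) {i : ℕ} (hi : i ≤ s) :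
    (initialSubmodule M x i).IsHomogeneous ℳ := by
  induction i with
  | zero =>
    rw [initialSubmodule_zero]
    exact isHomogeneous_bot
  | succ i ih =>
    have := initialSubmodule_succ (M := M) x ⟨i, hi⟩
    simp only at this
    rw [this]
    exact isHomogeneous_sup (ih (by omega)) (isHomogeneous_map_lsmul isHomogeneous_top (hx _))

theorem smul_mem_initialSubmodule {l : Fin s} {i : ℕ} (hl : (l : ℕ) < i) (m : M) :
    x l • m ∈ initialSubmodule M x i :=
  Submodule.smul_mem_smul (Ideal.subset_span ⟨l, hl, rfl⟩) trivial

-- Dimension at most zero means that every point of `Supp_{++}` is maximal in it. The antichain form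
-- is kept because it passes to subsets and allows the empty set.
omit [Module A M] [IsScalarTower A S M] in
theorem IsMixedMultiplicitySystem.isAntichain [Module.Finite S M] {x} {t : Fin s → Fin d}
    {k : Fin d → ℕ} (hx : IsMixedMultiplicitySystem 𝒜 M x t k) :
    IsAntichain (· ≤ ·)
      (zeroLocusPP 𝒜 ((⊥ : Submodule S M).colon ((⊤ : Submodule S M) : Set M) ⊔
        Ideal.span (Set.range x))) := by
  have hsub : zeroLocusPP 𝒜 ((⊥ : Submodule S M).colon ((⊤ : Submodule S M) : Set M) ⊔
      Ideal.span (Set.range x)) ⊆ suppPP 𝒜 (M ⧸ initialSubmodule M x s) := by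
    rintro P ⟨h1, h2, h3⟩
    refine ⟨h1, h2, ?_⟩
    rw [initialSubmodule, Module.support_quotient, Module.support_eq_zeroLocus]
    refine ⟨?_, ?_⟩
    · rw [PrimeSpectrum.mem_zeroLocus]
      refine fun r hr => h3 (Ideal.mem_sup_left (Submodule.mem_colon.2 fun m _ => ?_))
      exact (Submodule.mem_bot S).2 (Module.mem_annihilator.1 hr m)
    · rw [PrimeSpectrum.zeroLocus_span, PrimeSpectrum.mem_zeroLocus]
      rintro _ ⟨l, -, rfl⟩
      exact h3 (Ideal.mem_sup_right (Ideal.subset_span ⟨l, rfl⟩))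
  have hmax := Order.krullDim_nonpos_iff_forall_isMax.1 hx.dim_le
  intro P hP Q hQ hne hPQ
  refine hne (le_antisymm hPQ ?_)
  exact hmax ⟨P, hsub hP⟩ (show (⟨P, hsub hP⟩ : suppPP 𝒜 (M ⧸ initialSubmodule M x s)) ≤
    ⟨Q, hsub hQ⟩ from hPQ)

omit [Module A M] [IsScalarTower A S M] in
theorem IsMixedMultiplicitySystem.isAntichain_initialSubmodule [Module.Finite S M] {x}
    {t : Fin s → Fin d} {k : Fin d → ℕ} (hx : IsMixedMultiplicitySystem 𝒜 M x t k) (i : ℕ) :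
    IsAntichain (· ≤ ·) (zeroLocusPP 𝒜
      ((initialSubmodule M x i).colon ((⊤ : Submodule S M) : Set M) ⊔
        Ideal.span (x '' {l | i ≤ (l : ℕ)}))) := by
  refine hx.isAntichain.subset (zeroLocusPP_anti (sup_le ?_ (Ideal.span_le.2 ?_)))
  · exact (colon_mono_left bot_le).trans le_sup_left
  · rintro _ ⟨l, rfl⟩
    rcases lt_or_ge (l : ℕ) i with h | h
    · exact Ideal.mem_sup_left (Submodule.mem_colon.2 fun m _ =>
        smul_mem_initialSubmodule x h m)
    · exact Ideal.mem_sup_right (Ideal.subset_span ⟨l, h, rfl⟩)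

omit [Module A M] [IsScalarTower A S M] in
theorem IsMixedMultiplicitySystem.isAntichain_comap [Module.Finite S M] {x}
    {t : Fin s → Fin d} {k : Fin d → ℕ} (hx : IsMixedMultiplicitySystem 𝒜 M x t k) (i : Fin s) :
    IsAntichain (· ≤ ·) (zeroLocusPP 𝒜
      ((initialSubmodule M x i).colon
        (((initialSubmodule M x i).comap (LinearMap.lsmul S M (x i)) : Submodule S M) : Set M) ⊔
        Ideal.span (x '' {l | (i : ℕ) + 1 ≤ (l : ℕ)}))) := by
  refine (hx.isAntichain_initialSubmodule i).subset
    (zeroLocusPP_anti (sup_le ?_ (Ideal.span_le.2 ?_)))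
  · exact (colon_anti_right le_top).trans le_sup_left
  · rintro _ ⟨l, hl, rfl⟩
    rcases (show (i : ℕ) ≤ (l : ℕ) from hl).eq_or_lt with h | h
    · obtain rfl : i = l := Fin.ext h
      exact Ideal.mem_sup_left (Submodule.mem_colon.2 fun m hm => hm)
    · exact Ideal.mem_sup_right (Ideal.subset_span ⟨l, h, rfl⟩)

theorem initialSubmodule_le_comap (i : Fin s) :
    initialSubmodule M x i ≤ (initialSubmodule M x i).comap (LinearMap.lsmul S M (x i)) :=
  fun _ hy => Submodule.smul_mem _ _ hy

variable [IsArtinianRing A]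

theorem IsStandard.isHilbertExpansion_hilbertFunction [IsNoetherian S M] (hS : IsStandard 𝒜) :
    IsHilbertExpansion (hilbertFunction ℳ) (coeff ℳ (⊤ : Submodule S M)) := by
  have := hS.isHilbertExpansion_of_length_eq (ℳ := ℳ) (f := hilbertFunction ℳ)
    (isHomogeneous_bot (S := S)) (isHomogeneous_top (S := S)) fun n => by
      rw [component_top, component_bot, Module.length_bot, zero_add]
      rfl
  rwa [hS.coeff_bot, sub_zero] at this

theorem IsStandard.isHilbertExpansion_colonQuotient [IsNoetherian S M] (hS : IsStandard 𝒜)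
    {x} {t : Fin s → Fin d} (hx : ∀ l, x l ∈ 𝒜 (Pi.single (t l) 1)) (i : Fin s) :
    IsHilbertExpansion (hilbertFunction
        (subGrading (quotGrading ℳ (initialSubmodule M x i)) (colonQuotient M x i)))
      (coeff ℳ ((initialSubmodule M x i).comap (LinearMap.lsmul S M (x i))) -
        coeff ℳ (initialSubmodule M x i)) :=
  hS.isHilbertExpansion_of_length_eq (isHomogeneous_initialSubmodule hx i.2.le)
    (isHomogeneous_comap_lsmul (isHomogeneous_initialSubmodule hx i.2.le) (hx i))
    fun n => length_subGrading_quotGrading (initialSubmodule_le_comap x i) n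

theorem IsStandard.isHilbertExpansion_quotGrading [IsNoetherian S M] (hS : IsStandard 𝒜)
    {N : Submodule S M} (hN : N.IsHomogeneous ℳ) :
    IsHilbertExpansion (hilbertFunction (quotGrading ℳ N))
      (coeff ℳ (⊤ : Submodule S M) - coeff ℳ N) :=
  hS.isHilbertExpansion_of_length_eq hN isHomogeneous_top fun n => by
    rw [component_top]
    exact length_quotGrading N n

/-- The recursion for the mixed multiplicities of `M / (x_1, …, x_i) M`. -/
theorem IsMixedMultiplicitySystem.coeff_succ [Module.Finite S M] [IsNoetherian S M]
    (hS : IsStandard 𝒜) {x} {t : Fin s → Fin d} {k : Fin d → ℕ}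
    (hx : IsMixedMultiplicitySystem 𝒜 M x t k) (i : Fin s) :
    (coeff ℳ (⊤ : Submodule S M) - coeff ℳ (initialSubmodule M x (i + 1))) (tailType t (i + 1)) -
      (coeff ℳ (⊤ : Submodule S M) - coeff ℳ (initialSubmodule M x i)) (tailType t i) =
    (coeff ℳ ((initialSubmodule M x i).comap (LinearMap.lsmul S M (x i))) -
        coeff ℳ (initialSubmodule M x i)) (tailType t (i + 1)) := by
  have hL := isHomogeneous_initialSubmodule (M := M) (ℳ := ℳ) hx.mem i.2.le
  have hlt : tailType t (i + 1) < tailType t (i + 1) + Pi.single (t i) 1 :=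
    lt_add_of_pos_right _ (Pi.lt_def.2 ⟨zero_le, t i, by simp⟩)
  have hrel := hS.coeff_sup hL (isHomogeneous_top (S := S)) (hx.mem i) (tailType t (i + 1))
  -- Definedness for the colon quotient removes its coefficient at the shifted index, the one
  -- unwanted term of `coeff_sup`.
  have hdef := hS.coeff_eq_of_tailType_lt hx.mem i.2 hL (isHomogeneous_comap_lsmul hL (hx.mem i))
    (initialSubmodule_le_comap x i) (hx.isAntichain_comap i) hlt
  rw [← initialSubmodule_succ, top_inf_eq, hdef] at hrel
  rw [tailType_eq_succ_add t i]
  simp only [Finsupp.sub_apply]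
  linarith

end Sequences

end Graded

end MixedMult

/-! ### The main theorem -/

theorem mainTheorem3 {d : ℕ} (hd : 0 < d)
    {A : Type*} [CommRing A] [IsLocalRing A] [IsArtinianRing A]
    [Infinite (IsLocalRing.ResidueField A)]
    {S : Type*} [CommRing S] [Algebra A S]
    (𝒜 : (Fin d → ℕ) → Submodule A S) [GradedAlgebra 𝒜] (hS : MixedMult.IsStandard 𝒜)
    {M : Type*} [AddCommGroup M] [Module A M] [Module S M] [IsScalarTower A S M]
    [Module.Finite S M]
    (ℳ : (Fin d → ℕ) → Submodule A M) [DirectSum.Decomposition ℳ] [SetLike.GradedSMul 𝒜 ℳ]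
    {s : ℕ} (x : Fin s → S) (t : Fin s → Fin d) (k : Fin d → ℕ)
    (hx : MixedMult.IsMixedMultiplicitySystem 𝒜 M x t k) :
    MixedMult.MixedMultiplicityDefined ℳ k ∧
    (∀ i : Fin s, MixedMult.MixedMultiplicityDefined
      (MixedMult.subGrading
        (MixedMult.quotGrading ℳ (MixedMult.initialSubmodule M x i))
        (MixedMult.colonQuotient M x i))
      (k - MixedMult.initialType t (i + 1))) ∧
    ∀ᶠ n in Filter.atTop,
      Module.length A (MixedMult.quotGrading ℳ (MixedMult.initialSubmodule M x s) n) ≠ ⊤ ∧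
      MixedMult.mixedMultiplicity ℳ k =
        ((Module.length A
          (MixedMult.quotGrading ℳ (MixedMult.initialSubmodule M x s) n)).toNat : ℤ) -
        ∑ i : Fin s, MixedMult.mixedMultiplicity
          (MixedMult.subGrading
            (MixedMult.quotGrading ℳ (MixedMult.initialSubmodule M x i))
            (MixedMult.colonQuotient M x i))
          (k - MixedMult.initialType t (i + 1)) := by
  have := hS.isNoetherianRing
  have htop := hS.isHilbertExpansion_hilbertFunction (ℳ := ℳ)
  have hcol := fun i => hS.isHilbertExpansion_colonQuotient (ℳ := ℳ) hx.mem i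
  have hquot := hS.isHilbertExpansion_quotGrading
    (MixedMult.isHomogeneous_initialSubmodule (M := M) (ℳ := ℳ) hx.mem le_rfl)
  have hk : k = MixedMult.tailType t 0 := by
    rw [← hx.type_eq, MixedMult.initialType_self]
  have hsub : ∀ i, k - MixedMult.initialType t i = MixedMult.tailType t i := fun i => by
    rw [← hx.type_eq, MixedMult.initialType_sub]
  have hdef : ∀ i, i ≤ s → ∀ h, MixedMult.tailType t i < h →
      MixedMult.coeff ℳ (⊤ : Submodule S M) h =
        MixedMult.coeff ℳ (MixedMult.initialSubmodule M x i) h := fun i hi h hh =>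
    hS.coeff_eq_of_tailType_lt hx.mem hi (MixedMult.isHomogeneous_initialSubmodule hx.mem hi)
      MixedMult.isHomogeneous_top le_top (hx.isAntichain_initialSubmodule i) hh
  refine ⟨htop.mixedMultiplicityDefined fun h hh => ?_, fun i => ?_, ?_⟩
  · rw [hdef 0 s.zero_le h (hk ▸ hh), MixedMult.initialSubmodule_zero, hS.coeff_bot,
      Finsupp.zero_apply]
  · rw [hsub]
    refine (hcol i).mixedMultiplicityDefined fun h hh => ?_
    have hL := MixedMult.isHomogeneous_initialSubmodule (M := M) (ℳ := ℳ) hx.mem i.2.le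
    rw [Finsupp.sub_apply, sub_eq_zero]
    exact hS.coeff_eq_of_tailType_lt hx.mem i.2 hL
      (MixedMult.isHomogeneous_comap_lsmul hL (hx.mem i))
      (MixedMult.initialSubmodule_le_comap x i) (hx.isAntichain_comap i) hh
  -- After the whole sequence the tail type is `0`, so every coefficient of `M / xM` at a nonzero
  -- index vanishes.
  · have hconst : MixedMult.coeff ℳ (⊤ : Submodule S M) -
        MixedMult.coeff ℳ (MixedMult.initialSubmodule M x s) =
          Finsupp.single 0 ((MixedMult.coeff ℳ (⊤ : Submodule S M) -
            MixedMult.coeff ℳ (MixedMult.initialSubmodule M x s)) 0) := by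
      ext h
      by_cases h0 : h = 0
      · rw [h0, Finsupp.single_eq_same]
      · rw [Finsupp.single_eq_of_ne h0, Finsupp.sub_apply, sub_eq_zero]
        refine hdef s le_rfl h ?_
        rw [MixedMult.tailType_of_le t le_rfl]
        exact pos_iff_ne_zero.2 h0
    have hsum : ∑ i : Fin s, MixedMult.mixedMultiplicity
          (MixedMult.subGrading
            (MixedMult.quotGrading ℳ (MixedMult.initialSubmodule M x i))
            (MixedMult.colonQuotient M x i))
          (k - MixedMult.initialType t (i + 1)) =
        (MixedMult.coeff ℳ (⊤ : Submodule S M) -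
          MixedMult.coeff ℳ (MixedMult.initialSubmodule M x s)) 0 -
            MixedMult.mixedMultiplicity ℳ k := by
      -- The coefficient of `M / (x_1, …, x_i)M` at the type of the remaining members; its
      -- increments are the summands, so the sum telescopes.
      let E : ℕ → ℤ := fun i => (MixedMult.coeff ℳ (⊤ : Submodule S M) -
        MixedMult.coeff ℳ (MixedMult.initialSubmodule M x i)) (MixedMult.tailType t i)
      have hE : ∀ i : Fin s, MixedMult.mixedMultiplicity
          (MixedMult.subGrading
            (MixedMult.quotGrading ℳ (MixedMult.initialSubmodule M x i))
            (MixedMult.colonQuotient M x i))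
          (k - MixedMult.initialType t (i + 1)) = E (i + 1) - E i := fun i => by
        rw [MixedMult.mixedMultiplicity, (hcol i).hilbertCoeff_eq, hsub]
        exact (hx.coeff_succ hS i).symm
      rw [Finset.sum_congr rfl fun i _ => hE i,
        Fin.sum_univ_eq_sum_range (fun i => E (i + 1) - E i) s, Finset.sum_range_sub,
        MixedMult.mixedMultiplicity, htop.hilbertCoeff_eq]
      simp only [E]
      rw [MixedMult.tailType_of_le t le_rfl, MixedMult.initialSubmodule_zero, hS.coeff_bot,
        sub_zero, ← hk]
    filter_upwards [hquot] with n hn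
    refine ⟨hn.1, ?_⟩
    have hval := hn.2
    rw [hconst, MixedMult.binomSum_single_zero] at hval
    rw [hsum, ← hval]
    simp only [MixedMult.hilbertFunction]
    ring
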